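/- Let $\Bbbk$ be a field, let $S=\Bbbk[x_1,\dots,x_n]$ and $S'=\Bbbk[y_1,\dots,y_m]$ be polynomial rings with their fine gradings by $\mathbb{Z}^n$ and $\mathbb{Z}^m$, and let $I\subsetneq S$ and $I'\subsetneq S'$ be proper monomial ideals. The lcm-lattice $L_I$ is the set of exponent vectors of the least common multiples of sets of minimal monomial generators of $I$ (the lcm of the empty set being $1$), ordered by divisibility. Let $\nu\colon L_I\to L_{I'}$ be an isomorphism of lattices. Let $(\mathbb{F},\partial)$ be a multigraded minimal free resolution of $S/I$ over $S$ with $\mathbb{F}_0=S$, regarded as the graded module $\bigoplus_i\mathbb{F}_i$, with homological degree $|\cdot|$ and multidegree $\deg$. A *multiplication* on $\mathbb{F}$ is an $S$-linear map $*\colon\mathbb{F}\otimes_S\mathbb{F}\to\mathbb{F}$ that respects the multigrading and the homological grading, extends the usual multiplication on $\mathbb{F}_0=S$, and satisfies $\partial(a*b)=\partial a*b+(-1)^{|a|}a*\partial b$ and $a*b=(-1)^{|a||b|}\,b*a$ (it need not be associative). It is *supportive* if for all homogeneous $a,b\in\mathbb{F}$ there are a homogeneous $c\in\mathbb{F}$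 with $\deg c\le\deg a\vee\deg b$ (componentwise maximum) and a monomial $m\in S$ with $a*b=mc$. Let $\mathcal{B}$ be a homogeneous basis of $\mathbb{F}$, and write $\partial\mathbf{g}=\sum_{\mathbf{h}\in\mathcal{B}}c_{\mathbf{g}}^{\mathbf{h}}\,x^{\deg\mathbf{g}-\deg\mathbf{h}}\,\mathbf{h}$ with $c_{\mathbf{g}}^{\mathbf{h}}\in\Bbbk$ (and $c_{\mathbf g}^{\mathbf h}=0$ if $\deg\mathbf{h}\not\le\deg\mathbf{g}$). Then $\deg\mathbf{g}\in L_I$ for all $\mathbf{g}\in\mathcal{B}$, and there is a multigraded minimal free resolution $\nu(\mathbb{F})$ of $S'/I'$ with $\nu(\mathbb{F})_0=S'$, with a basis $\{\bar{\mathbf{g}}:\mathbf{g}\in\mathcal{B}\}$ such that $|\bar{\mathbf{g}}|=|\mathbf{g}|$ and $\deg\bar{\mathbf{g}}=\nu(\deg\mathbf{g})$, and with the differential $$\bar\partial\bar{\mathbf{g}}=\sum_{\mathbf{h}\in\mathcal{B}}c_{\mathbf{g}}^{\mathbf{h}}\,y^{\deg\bar{\mathbf{g}}-\deg\bar{\mathbf{h}}}\,\bar{\mathbf{h}}$$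 (all exponents that occur with a non-zero coefficient being non-negative). Moreover, for every supportive multiplication $$\mathbf{g}_1*\mathbf{g}_2=\sum_{\mathbf{h}\in\mathcal{B}}c_{\mathbf{g}_1,\mathbf{g}_2}^{\mathbf{h}}\,x^{\deg\mathbf{g}_1+\deg\mathbf{g}_2-\deg\mathbf{h}}\,\mathbf{h},\qquad c_{\mathbf{g}_1,\mathbf{g}_2}^{\mathbf{h}}\in\Bbbk,$$ on $\mathbb{F}$, the formula $$\bar{\mathbf{g}}_1*\bar{\mathbf{g}}_2=\sum_{\mathbf{h}\in\mathcal{B}}c_{\mathbf{g}_1,\mathbf{g}_2}^{\mathbf{h}}\,y^{\deg\bar{\mathbf{g}}_1+\deg\bar{\mathbf{g}}_2-\deg\bar{\mathbf{h}}}\,\bar{\mathbf{h}}$$ is well-defined in the same sense and gives a supportive multiplication on $\nu(\mathbb{F})$; and if $1\in\mathbb{F}_0$ satisfies $1*a=a$ for all $a\in\mathbb{F}$, then $1\in\nu(\mathbb{F})_0$ has the same property. -/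

import Mathlib

open MvPolynomial

noncomputable section

/-- `I` is a monomial ideal: it is generated by a set of monomials. -/
def IsMonomialIdeal {𝕜 σ : Type*} [Field 𝕜] (I : Ideal (MvPolynomial σ 𝕜)) : Prop :=
  ∃ A : Set (σ →₀ ℕ), I = Ideal.span ((fun u => monomial u (1 : 𝕜)) '' A)

/-- The exponent vectors of the minimal monomial generators of `I`, i.e. of the monomials in `I`
that are minimal for divisibility. -/
def minimalGenerators {𝕜 σ : Type*} [Field 𝕜] (I : Ideal (MvPolynomial σ 𝕜)) : Set (σ →₀ ℕ) :=
  {u | Minimal (fun v : σ →₀ ℕ => monomial v (1 : 𝕜) ∈ I) u}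

/-- The lcm-lattice of `I`: the exponent vectors of the least common multiples of the finite sets of
minimal generators (including the empty one, whose lcm is `1`), ordered by divisibility, that is,
componentwise. The lcm is the componentwise maximum of exponents. -/
def lcmLattice {𝕜 σ : Type*} [Field 𝕜] (I : Ideal (MvPolynomial σ 𝕜)) : Set (σ →₀ ℕ) :=
  {w | ∃ W : Finset (σ →₀ ℕ), (W : Set (σ →₀ ℕ)) ⊆ minimalGenerators I ∧ W.sup id = w}

/-- An exponent vector, viewed as a multidegree in `ℤ^σ`. -/
def toMultidegree {σ : Type*} (u : σ →₀ ℕ) : σ → ℤ := fun s => (u s : ℤ)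

/-- The coefficient of the Laurent monomial `x^e`, `e ∈ ℤ^σ`, in a polynomial; it vanishes if `e`
has a negative entry. -/
def laurentCoeff {𝕜 σ : Type*} [Field 𝕜] [Finite σ] (e : σ → ℤ)
    (p : MvPolynomial σ 𝕜) : 𝕜 :=
  open Classical in
  if 0 ≤ e then p.coeff (Finsupp.equivFunOnFinite.symm fun s => (e s).toNat) else 0

/-- The data of a (homologically and multi-)graded free module over `S = 𝕜[x_s : s ∈ σ]` with a chosen
basis `(g)_{g ∈ ι}` of homogeneous elements of homological degree `hdeg g` and multidegree `mdeg g`,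
together with an endomorphism `d` and a distinguished element `one`. The module `F` stands for the
direct sum `⨁ i, F_i`. The axioms on `d` and `one` are in `IsMinimalFreeResolution`. -/
structure BasedComplex (𝕜 σ ι F : Type*) [Field 𝕜] [AddCommGroup F]
    [Module (MvPolynomial σ 𝕜) F] where
  /-- the homogeneous basis -/
  basis : Module.Basis ι (MvPolynomial σ 𝕜) F
  /-- the homological degrees of the basis elements -/
  hdeg : ι → ℕ
  /-- the multidegrees of the basis elements -/
  mdeg : ι → σ → ℤ
  /-- the differential -/
  d : F →ₗ[MvPolynomial σ 𝕜] F
  /-- the element of `F_0` that corresponds to `1` under the identification `F_0 = S` -/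
  one : F

namespace BasedComplex

/-- The component `F_i` of homological degree `i`. -/
def hpart {𝕜 σ ι F : Type*} [Field 𝕜] [AddCommGroup F] [Module (MvPolynomial σ 𝕜) F]
    (C : BasedComplex 𝕜 σ ι F) (i : ℕ) : Submodule (MvPolynomial σ 𝕜) F :=
  Submodule.span (MvPolynomial σ 𝕜) (C.basis '' {g | C.hdeg g = i})

/-- `x` is homogeneous of multidegree `e`: every term `x^u g` that occurs in it satisfies
`u + deg g = e`. (Zero is homogeneous of every multidegree.) -/
def IsMultihomogeneous {𝕜 σ ι F : Type*} [Field 𝕜] [AddCommGroup F] [Module (MvPolynomial σ 𝕜) F]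
    (C : BasedComplex 𝕜 σ ι F) (e : σ → ℤ) (x : F) : Prop :=
  ∀ g : ι, ∀ u ∈ (C.basis.repr x g).support, toMultidegree u + C.mdeg g = e

/-- `C` is a multigraded minimal free resolution of `S/I` with `F_0 = S`. -/
structure IsMinimalFreeResolution {𝕜 σ ι F : Type*} [Field 𝕜] [AddCommGroup F]
    [Module (MvPolynomial σ 𝕜) F] (C : BasedComplex 𝕜 σ ι F) (I : Ideal (MvPolynomial σ 𝕜)) :
    Prop where
  d_mem : ∀ i : ℕ, ∀ x ∈ C.hpart (i + 1), C.d x ∈ C.hpart i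
  d_zero : ∀ x ∈ C.hpart 0, C.d x = 0
  d_multihomogeneous : ∀ (e : σ → ℤ) (x : F),
    C.IsMultihomogeneous e x → C.IsMultihomogeneous e (C.d x)
  d_comp_d : ∀ x : F, C.d (C.d x) = 0
  exact : ∀ i : ℕ, ∀ x ∈ C.hpart (i + 1), C.d x = 0 → ∃ y ∈ C.hpart (i + 2), C.d y = x
  /-- `r ↦ r • one` identifies `S` with `F_0`, as multigraded modules -/
  one_multihomogeneous : C.IsMultihomogeneous 0 C.one
  hpart_zero : C.hpart 0 = Submodule.span (MvPolynomial σ 𝕜) {C.one}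
  smul_one_injective : Function.Injective fun r : MvPolynomial σ 𝕜 => r • C.one
  /-- the image of `F_1` in `F_0 = S` is `I`, so that the cokernel is `S/I` -/
  smul_one_mem : ∀ r : MvPolynomial σ 𝕜, (∃ y ∈ C.hpart 1, C.d y = r • C.one) ↔ r ∈ I
  /-- minimality: `d F ⊆ 𝔪 F`, where `𝔪` is generated by the variables -/
  minimal : ∀ x : F, C.d x ∈ Ideal.span (Set.range (X : σ → MvPolynomial σ 𝕜)) •
    (⊤ : Submodule (MvPolynomial σ 𝕜) F)

/-- An `S`-bilinear map `F × F → F` is a multiplication: it satisfies the axioms of a multigraded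
differential graded algebra, except possibly associativity. -/
structure IsMultiplication {𝕜 σ ι F : Type*} [Field 𝕜] [AddCommGroup F]
    [Module (MvPolynomial σ 𝕜) F] (C : BasedComplex 𝕜 σ ι F)
    (mul : F →ₗ[MvPolynomial σ 𝕜] F →ₗ[MvPolynomial σ 𝕜] F) : Prop where
  /-- it extends the usual multiplication on `F_0 = S` -/
  mul_F0 : ∀ r s : MvPolynomial σ 𝕜, mul (r • C.one) (s • C.one) = (r * s) • C.one
  leibniz : ∀ i : ℕ, ∀ a ∈ C.hpart i, ∀ b : F,
    C.d (mul a b) = mul (C.d a) b + (-1 : ℤ) ^ i • mul a (C.d b)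
  hdeg_mul : ∀ i j : ℕ, ∀ a ∈ C.hpart i, ∀ b ∈ C.hpart j, mul a b ∈ C.hpart (i + j)
  graded_comm : ∀ i j : ℕ, ∀ a ∈ C.hpart i, ∀ b ∈ C.hpart j,
    mul a b = (-1 : ℤ) ^ (i * j) • mul b a
  multihomogeneous_mul : ∀ (e f : σ → ℤ) (a b : F), C.IsMultihomogeneous e a →
    C.IsMultihomogeneous f b → C.IsMultihomogeneous (e + f) (mul a b)

/-- A multiplication is supportive if for all homogeneous `a`, `b` there are a homogeneous `c` with
`deg c ≤ deg a ∨ deg b` and a monomial `m = x^u` such that `a * b = m c`. -/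
def IsSupportive {𝕜 σ ι F : Type*} [Field 𝕜] [AddCommGroup F] [Module (MvPolynomial σ 𝕜) F]
    (C : BasedComplex 𝕜 σ ι F)
    (mul : F →ₗ[MvPolynomial σ 𝕜] F →ₗ[MvPolynomial σ 𝕜] F) : Prop :=
  ∀ (e f : σ → ℤ) (a b : F), C.IsMultihomogeneous e a → C.IsMultihomogeneous f b →
    ∃ (u : σ →₀ ℕ) (e' : σ → ℤ) (c : F), C.IsMultihomogeneous e' c ∧ e' ≤ e ⊔ f ∧
      mul a b = monomial u (1 : 𝕜) • c

/-- The structure constant `c_g^h ∈ 𝕜` of the differential, in the expansion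
`d g = ∑ h, c_g^h x^(deg g - deg h) h`. -/
def diffConst {𝕜 σ ι F : Type*} [Field 𝕜] [Finite σ] [AddCommGroup F]
    [Module (MvPolynomial σ 𝕜) F] (C : BasedComplex 𝕜 σ ι F) (g h : ι) : 𝕜 :=
  laurentCoeff (C.mdeg g - C.mdeg h) (C.basis.repr (C.d (C.basis g)) h)

/-- The structure constant `c_{g₁,g₂}^h ∈ 𝕜` of a multiplication, in the expansion
`g₁ * g₂ = ∑ h, c_{g₁,g₂}^h x^(deg g₁ + deg g₂ - deg h) h`. -/
def mulConst {𝕜 σ ι F : Type*} [Field 𝕜] [Finite σ] [AddCommGroup F]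
    [Module (MvPolynomial σ 𝕜) F] (C : BasedComplex 𝕜 σ ι F)
    (mul : F →ₗ[MvPolynomial σ 𝕜] F →ₗ[MvPolynomial σ 𝕜] F) (g₁ g₂ h : ι) : 𝕜 :=
  laurentCoeff (C.mdeg g₁ + C.mdeg g₂ - C.mdeg h) (C.basis.repr (mul (C.basis g₁) (C.basis g₂)) h)

/-- `C'` is the relabeling of `C` along `ν : L_I ≃o L_{I'}`: its basis is indexed by the basis of `C`,
the basis elements keep their homological degrees, all multidegrees of basis elements of `C` lie in
`L_I` and are replaced by their images under `ν`, and the structure constants of the differential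
are kept. -/
structure IsRelabeling {𝕜 σ σ' ι F F' : Type*} [Field 𝕜] [Finite σ] [Finite σ'] [AddCommGroup F]
    [Module (MvPolynomial σ 𝕜) F] [AddCommGroup F'] [Module (MvPolynomial σ' 𝕜) F']
    {I : Ideal (MvPolynomial σ 𝕜)} {I' : Ideal (MvPolynomial σ' 𝕜)}
    (ν : lcmLattice I ≃o lcmLattice I')
    (C : BasedComplex 𝕜 σ ι F) (C' : BasedComplex 𝕜 σ' ι F') : Prop where
  hdeg_eq : ∀ g, C'.hdeg g = C.hdeg g
  mdeg_eq : ∀ g, ∃ w : lcmLattice I, C.mdeg g = toMultidegree (w : σ →₀ ℕ) ∧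
    C'.mdeg g = toMultidegree (ν w : σ' →₀ ℕ)
  diffConst_eq : ∀ g h, C'.diffConst g h = C.diffConst g h

/-- `mul'` is the relabeling of `mul`: it has the same structure constants. -/
def IsMulRelabeling {𝕜 σ σ' ι F F' : Type*} [Field 𝕜] [Finite σ] [Finite σ'] [AddCommGroup F]
    [Module (MvPolynomial σ 𝕜) F] [AddCommGroup F'] [Module (MvPolynomial σ' 𝕜) F']
    (C : BasedComplex 𝕜 σ ι F) (C' : BasedComplex 𝕜 σ' ι F')
    (mul : F →ₗ[MvPolynomial σ 𝕜] F →ₗ[MvPolynomial σ 𝕜] F)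
    (mul' : F' →ₗ[MvPolynomial σ' 𝕜] F' →ₗ[MvPolynomial σ' 𝕜] F') : Prop :=
  ∀ g₁ g₂ h, C'.mulConst mul' g₁ g₂ h = C.mulConst mul g₁ g₂ h

end BasedComplex

end

/-! Setting all variables to 1 turns the resolution into a complex of vector spaces on `ι →₀ 𝕜`,
whose matrix `D` consists of the structure constants. The multidegrees survive as the family of
subspaces `lower 𝕜 m e`, spanned by the basis elements of multidegree at most `e`: the component of
`F` of multidegree `e` is isomorphic to `lower 𝕜 m e` (via `strand` and `homog`), and the
differential acts on all these components by the same `D`. Being a multigraded minimal free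
resolution of `S/I` is therefore a condition, `IsFrame`, on `D` and this family;
`IsMinimalFreeResolution.isFrame` and `isMinimalFreeResolution_ofFrame` are the two directions.

All multidegrees of basis elements lie in the lcm-lattice (`IsFrame.mdeg_mem_lcmLattice`), and every
exponent `u` has a greatest lattice element `w` below it. Hence `lower` is the same at `u` and at
`w`, and `x^u ∈ I` iff `x^w ∈ I`. The only lattice element whose monomial is not in the proper ideal
`I` is 0, the bottom. Since `ν` preserves the order and the bottom, every subspace that must be
tested for `I'` is zero or has already been tested for `I` (`IsDegreeRelabeling.exists_lower_eq`),
and the axioms carry over (`IsFrame.relabel`).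

For a multiplication, being supportive means that the product of basis elements `g`, `h` has its
coordinates in `lower` at `deg g ⊔ deg h`. This bound involves only joins, which `ν` preserves,
whereas the sum `deg g + deg h` has no meaning in the lattice. The remaining axioms on the structure
constants do not mention multidegrees (`IsMulFrame.relabel`). -/

noncomputable section

/-! ### Laurent exponents and coefficients -/

section Laurent

variable {𝕜 σ : Type*} [Field 𝕜]

theorem toMultidegree_nonneg (u : σ →₀ ℕ) : 0 ≤ toMultidegree u :=
  fun s => Int.natCast_nonneg (u s)

@[simp]
theorem toMultidegree_zero : toMultidegree (0 : σ →₀ ℕ) = 0 := by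
  ext s; simp [toMultidegree]

theorem toMultidegree_add (u v : σ →₀ ℕ) :
    toMultidegree (u + v) = toMultidegree u + toMultidegree v := by
  ext s; simp [toMultidegree]

theorem toMultidegree_sup (u v : σ →₀ ℕ) :
    toMultidegree (u ⊔ v) = toMultidegree u ⊔ toMultidegree v := by
  ext s; simp [toMultidegree]

theorem toMultidegree_le {u v : σ →₀ ℕ} : toMultidegree u ≤ toMultidegree v ↔ u ≤ v := by
  simp [toMultidegree, Pi.le_def, Finsupp.le_def]

theorem toMultidegree_injective : Function.Injective (toMultidegree : (σ →₀ ℕ) → σ → ℤ) := by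
  intro u v h
  ext s
  simpa [toMultidegree] using congrFun h s

variable [Finite σ]

/-- The exponent vector with entries the positive parts of those of `e`. -/
def natExponent (e : σ → ℤ) : σ →₀ ℕ := Finsupp.equivFunOnFinite.symm fun s => (e s).toNat

@[simp]
theorem natExponent_toMultidegree (u : σ →₀ ℕ) : natExponent (toMultidegree u) = u := by
  ext s; simp [natExponent, toMultidegree]

theorem toMultidegree_natExponent {e : σ → ℤ} (he : 0 ≤ e) :
    toMultidegree (natExponent e) = e := by
  ext s
  have := he s
  simpa [natExponent, toMultidegree] using this

theorem exists_toMultidegree_eq {e : σ → ℤ} (he : 0 ≤ e) : ∃ u, toMultidegree u = e :=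
  ⟨_, toMultidegree_natExponent he⟩

theorem laurentCoeff_toMultidegree (u : σ →₀ ℕ) (p : MvPolynomial σ 𝕜) :
    laurentCoeff (toMultidegree u) p = p.coeff u := by
  rw [laurentCoeff, if_pos (toMultidegree_nonneg u)]
  exact congrArg (fun v => p.coeff v) (natExponent_toMultidegree u)

theorem laurentCoeff_of_not_nonneg {e : σ → ℤ} (he : ¬ 0 ≤ e) (p : MvPolynomial σ 𝕜) :
    laurentCoeff e p = 0 := by
  rw [laurentCoeff, if_neg he]

theorem laurentCoeff_add (e : σ → ℤ) (p q : MvPolynomial σ 𝕜) :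
    laurentCoeff e (p + q) = laurentCoeff e p + laurentCoeff e q := by
  unfold laurentCoeff; split_ifs <;> simp

theorem laurentCoeff_smul (e : σ → ℤ) (c : 𝕜) (p : MvPolynomial σ 𝕜) :
    laurentCoeff e (c • p) = c * laurentCoeff e p := by
  unfold laurentCoeff; split_ifs <;> simp

@[simp]
theorem laurentCoeff_zero (e : σ → ℤ) : laurentCoeff e (0 : MvPolynomial σ 𝕜) = 0 := by
  unfold laurentCoeff; split_ifs <;> simp

theorem laurentCoeff_ext {p q : MvPolynomial σ 𝕜} (f : σ → ℤ)
    (h : ∀ e, laurentCoeff (e - f) p = laurentCoeff (e - f) q) : p = q := by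
  ext u
  have := h (toMultidegree u + f)
  rwa [add_sub_cancel_right, laurentCoeff_toMultidegree, laurentCoeff_toMultidegree] at this

/-- The term `c x^e`, understood as zero if `e` has a negative entry. -/
def laurentMonomial (𝕜 : Type*) [Field 𝕜] (e : σ → ℤ) : 𝕜 →ₗ[𝕜] MvPolynomial σ 𝕜 :=
  open Classical in
  if 0 ≤ e then monomial (natExponent e) else 0

theorem laurentMonomial_toMultidegree (u : σ →₀ ℕ) (c : 𝕜) :
    laurentMonomial 𝕜 (toMultidegree u) c = monomial u c := by
  rw [laurentMonomial, if_pos (toMultidegree_nonneg u), natExponent_toMultidegree]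

theorem laurentMonomial_of_not_nonneg {e : σ → ℤ} (he : ¬ 0 ≤ e) : laurentMonomial 𝕜 e = 0 := by
  rw [laurentMonomial, if_neg he]

theorem laurentCoeff_laurentMonomial {e : σ → ℤ} (he : 0 ≤ e) (c : 𝕜) :
    laurentCoeff e (laurentMonomial 𝕜 e c) = c := by
  classical
  obtain ⟨u, rfl⟩ := exists_toMultidegree_eq he
  rw [laurentMonomial_toMultidegree, laurentCoeff_toMultidegree, coeff_monomial,
    if_pos rfl]

theorem laurentCoeff_laurentMonomial_of_ne {e f : σ → ℤ} (h : f ≠ e) (c : 𝕜) :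
    laurentCoeff f (laurentMonomial 𝕜 e c) = 0 := by
  classical
  by_cases he : 0 ≤ e
  · by_cases hf : 0 ≤ f
    · obtain ⟨u, rfl⟩ := exists_toMultidegree_eq he
      obtain ⟨v, rfl⟩ := exists_toMultidegree_eq hf
      rw [laurentMonomial_toMultidegree, laurentCoeff_toMultidegree, coeff_monomial, if_neg]
      rintro rfl
      exact h rfl
    · exact laurentCoeff_of_not_nonneg hf _
  · simp [laurentMonomial_of_not_nonneg he]

end Laurent

/-! ### Subspaces of bounded multidegree and of fixed homological degree -/

section Support

variable {𝕜 σ ι : Type*} [Field 𝕜]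

/-- The vectors supported on the indices of multidegree at most `e`. -/
def lower (𝕜 : Type*) [Field 𝕜] (m : ι → σ → ℤ) (e : σ → ℤ) : Submodule 𝕜 (ι →₀ 𝕜) :=
  Finsupp.supported 𝕜 𝕜 {g | m g ≤ e}

/-- The vectors supported on the indices of homological degree `i`. -/
def level (𝕜 : Type*) [Field 𝕜] (hd : ι → ℕ) (i : ℕ) : Submodule 𝕜 (ι →₀ 𝕜) :=
  Finsupp.supported 𝕜 𝕜 {g | hd g = i}

theorem mem_lower {m : ι → σ → ℤ} {e : σ → ℤ} {v : ι →₀ 𝕜} :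
    v ∈ lower 𝕜 m e ↔ ∀ g, v g ≠ 0 → m g ≤ e := by
  simp [lower, Finsupp.mem_supported, Set.subset_def]

theorem mem_level {hd : ι → ℕ} {i : ℕ} {v : ι →₀ 𝕜} :
    v ∈ level 𝕜 hd i ↔ ∀ g, v g ≠ 0 → hd g = i := by
  simp [level, Finsupp.mem_supported, Set.subset_def]

theorem single_mem_lower {m : ι → σ → ℤ} {e : σ → ℤ} {g : ι} (h : m g ≤ e) (c : 𝕜) :
    Finsupp.single g c ∈ lower 𝕜 m e :=
  Finsupp.single_mem_supported 𝕜 c h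

theorem single_mem_level {hd : ι → ℕ} {i : ℕ} {g : ι} (h : hd g = i) (c : 𝕜) :
    Finsupp.single g c ∈ level 𝕜 hd i :=
  Finsupp.single_mem_supported 𝕜 c h

theorem lower_mono (m : ι → σ → ℤ) {e f : σ → ℤ} (h : e ≤ f) : lower 𝕜 m e ≤ lower 𝕜 m f :=
  Finsupp.supported_mono fun _ hg => le_trans hg h

theorem lower_induction {m : ι → σ → ℤ} {e : σ → ℤ} {p : (ι →₀ 𝕜) → Prop}
    (single : ∀ g, m g ≤ e → p (Finsupp.single g 1)) (zero : p 0)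
    (add : ∀ v w, p v → p w → p (v + w)) (smul : ∀ (c : 𝕜) v, p v → p (c • v))
    {v : ι →₀ 𝕜} (hv : v ∈ lower 𝕜 m e) : p v := by
  rw [lower, Finsupp.supported_eq_span_single] at hv
  induction hv using Submodule.span_induction with
  | mem x hx => obtain ⟨g, hg, rfl⟩ := hx; exact single g hg
  | zero => exact zero
  | add x y _ _ hx hy => exact add x y hx hy
  | smul c x _ hx => exact smul c x hx

theorem map_mem_lower {m : ι → σ → ℤ} {D : (ι →₀ 𝕜) →ₗ[𝕜] (ι →₀ 𝕜)}
    (hD : ∀ g, D (Finsupp.single g 1) ∈ lower 𝕜 m (m g)) {e : σ → ℤ} {v : ι →₀ 𝕜}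
    (hv : v ∈ lower 𝕜 m e) : D v ∈ lower 𝕜 m e := by
  refine lower_induction (p := fun v => D v ∈ lower 𝕜 m e) ?_ (by simp) ?_ ?_ hv
  · exact fun g hg => lower_mono m hg (hD g)
  · intro v w hv hw
    rw [map_add]; exact add_mem hv hw
  · intro c v hv
    rw [map_smul]; exact Submodule.smul_mem _ _ hv

end Support

/-! ### Homogeneous components as coordinate vectors -/

section Strand

variable {𝕜 σ ι F : Type*} [Field 𝕜] [Finite σ] [AddCommGroup F] [Module (MvPolynomial σ 𝕜) F]
  [Module 𝕜 F] [IsScalarTower 𝕜 (MvPolynomial σ 𝕜) F]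

/-- The coefficient vector of the homogeneous component of multidegree `e`. -/
def strand (b : Module.Basis ι (MvPolynomial σ 𝕜) F) (m : ι → σ → ℤ) (e : σ → ℤ) :
    F →ₗ[𝕜] (ι →₀ 𝕜) where
  toFun x := Finsupp.onFinset (b.repr x).support (fun g => laurentCoeff (e - m g) (b.repr x g))
    (by
      intro g hg
      rw [Finsupp.mem_support_iff]
      intro h
      exact hg (by rw [h, laurentCoeff_zero]))
  map_add' x y := by ext g; simp [laurentCoeff_add]
  map_smul' c x := by
    ext g
    have : b.repr (c • x) = c • b.repr x := by
      rw [← algebraMap_smul (MvPolynomial σ 𝕜) c x, map_smul, algebraMap_smul]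
    simp [this, laurentCoeff_smul]

/-- The homogeneous element `∑ g, v_g x^(e - deg g) g` of multidegree `e`. -/
def homog (b : Module.Basis ι (MvPolynomial σ 𝕜) F) (m : ι → σ → ℤ) (e : σ → ℤ) :
    (ι →₀ 𝕜) →ₗ[𝕜] F :=
  Finsupp.lsum 𝕜 fun g =>
    ((LinearMap.toSpanSingleton (MvPolynomial σ 𝕜) F (b g)).restrictScalars 𝕜) ∘ₗ
      laurentMonomial 𝕜 (e - m g)

variable (b : Module.Basis ι (MvPolynomial σ 𝕜) F) (m : ι → σ → ℤ)

theorem strand_apply (e : σ → ℤ) (x : F) (g : ι) :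
    strand b m e x g = laurentCoeff (e - m g) (b.repr x g) := rfl

theorem homog_single (e : σ → ℤ) (g : ι) (c : 𝕜) :
    homog b m e (Finsupp.single g c) = laurentMonomial 𝕜 (e - m g) c • b g := by
  simp [homog]

theorem homog_single_toMultidegree (u : σ →₀ ℕ) (g : ι) (c : 𝕜) :
    homog b m (toMultidegree u + m g) (Finsupp.single g c) = monomial u c • b g := by
  rw [homog_single, add_sub_cancel_right, laurentMonomial_toMultidegree]

theorem homog_single_self (g : ι) : homog b m (m g) (Finsupp.single g (1 : 𝕜)) = b g := by
  have := homog_single_toMultidegree b m 0 g (1 : 𝕜)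
  simpa using this

theorem repr_homog (e : σ → ℤ) (v : ι →₀ 𝕜) (g : ι) :
    b.repr (homog b m e v) g = laurentMonomial 𝕜 (e - m g) (v g) := by
  classical
  induction v using Finsupp.induction_linear with
  | zero => simp
  | add v w hv hw => simp [hv, hw]
  | single h c =>
    rw [homog_single, map_smul, Finsupp.smul_apply, Module.Basis.repr_self]
    by_cases hg : h = g
    · subst hg; simp
    · simp [hg]

theorem strand_mem_lower (e : σ → ℤ) (x : F) : strand b m e x ∈ lower 𝕜 m e := by
  rw [mem_lower]
  intro g hg
  by_contra h
  refine hg (laurentCoeff_of_not_nonneg ?_ _)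
  rwa [sub_nonneg]

theorem strand_homog {e : σ → ℤ} {v : ι →₀ 𝕜} (hv : v ∈ lower 𝕜 m e) :
    strand b m e (homog b m e v) = v := by
  ext g
  rw [strand_apply, repr_homog]
  by_cases hg : v g = 0
  · simp [hg]
  · exact laurentCoeff_laurentMonomial (sub_nonneg.2 (mem_lower.1 hv g hg)) _

theorem strand_homog_of_ne {e f : σ → ℤ} (h : f ≠ e) (v : ι →₀ 𝕜) :
    strand b m f (homog b m e v) = 0 := by
  ext g
  rw [strand_apply, repr_homog]
  exact laurentCoeff_laurentMonomial_of_ne (by simpa using h) _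

variable {b} in
theorem strand_ext {x y : F} (h : ∀ e, strand b m e x = strand b m e y) : x = y := by
  apply b.repr.injective
  ext1 g
  refine laurentCoeff_ext (m g) fun e => ?_
  rw [← strand_apply, ← strand_apply, h]

theorem homogeneous_iff (x : F) (e : σ → ℤ) :
    (∀ g : ι, ∀ u ∈ (b.repr x g).support, toMultidegree u + m g = e) ↔
      ∀ f, f ≠ e → strand b m f x = 0 := by
  constructor
  · intro h f hf
    ext g
    rw [strand_apply, Finsupp.zero_apply]
    by_cases h0 : 0 ≤ f - m g
    · obtain ⟨u, hu⟩ := exists_toMultidegree_eq h0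
      rw [← hu, laurentCoeff_toMultidegree]
      by_contra hne
      refine hf ?_
      rw [← h g u (mem_support_iff.2 hne), hu, sub_add_cancel]
    · exact laurentCoeff_of_not_nonneg h0 _
  · intro h g u hu
    by_contra hne
    have := DFunLike.congr_fun (h _ hne) g
    rw [strand_apply, add_sub_cancel_right, laurentCoeff_toMultidegree] at this
    exact mem_support_iff.1 hu this

variable {b m} in
theorem eq_homog_strand {x : F} {e : σ → ℤ} (h : ∀ f, f ≠ e → strand b m f x = 0) :
    x = homog b m e (strand b m e x) := by
  refine strand_ext (b := b) m fun f => ?_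
  by_cases hf : f = e
  · subst hf
    rw [strand_homog b m (strand_mem_lower b m f x)]
  · rw [h f hf, strand_homog_of_ne b m hf]

/-- Multiplication by a monomial becomes the inclusion of `lower` at `e` into `lower` at `u + e`.
The hypothesis on `v` matters: `homog` at `e` drops the coordinates outside `lower`, and some of
these may survive at `u + e`. -/
theorem monomial_smul_homog (u : σ →₀ ℕ) {e : σ → ℤ} {v : ι →₀ 𝕜} (hv : v ∈ lower 𝕜 m e) :
    monomial u (1 : 𝕜) • homog b m e v = homog b m (toMultidegree u + e) v := by
  refine lower_induction (p := fun v => monomial u (1 : 𝕜) • homog b m e v =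
    homog b m (toMultidegree u + e) v) ?_ (by simp) ?_ ?_ hv
  · intro g hg
    obtain ⟨w, hw⟩ := exists_toMultidegree_eq (sub_nonneg.2 hg)
    rw [homog_single, homog_single, add_sub_assoc, ← hw, ← toMultidegree_add,
      laurentMonomial_toMultidegree, laurentMonomial_toMultidegree, smul_smul, monomial_mul, one_mul]
  · intro v w hv hw
    rw [map_add, map_add, smul_add, hv, hw]
  · intro c v hv
    rw [map_smul, map_smul, ← hv, smul_comm]

variable {b} in
theorem homog_induction {p : F → Prop} (zero : p 0) (add : ∀ x y, p x → p y → p (x + y))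
    (homog : ∀ e, ∀ v ∈ lower 𝕜 m e, p (homog b m e v)) (x : F) : p x := by
  rw [← b.linearCombination_repr x]
  induction b.repr x using Finsupp.induction_linear with
  | zero => simpa using zero
  | add v w hv hw => rw [map_add]; exact add _ _ hv hw
  | single g q =>
    rw [Finsupp.linearCombination_single]
    induction q using MvPolynomial.induction_on' with
    | monomial u c =>
      rw [← homog_single_toMultidegree b m]
      exact homog _ _ (single_mem_lower (le_add_of_nonneg_left (toMultidegree_nonneg u)) c)
    | add q r hq hr => rw [add_smul]; exact add _ _ hq hr

theorem exists_finset_strand_eq_zero (x : F) :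
    ∃ E : Finset (σ → ℤ), ∀ e, e ∉ E → strand b m e x = 0 := by
  classical
  induction x using homog_induction (b := b) m with
  | zero => exact ⟨∅, by simp⟩
  | add x y hx hy =>
    obtain ⟨E, hE⟩ := hx
    obtain ⟨E', hE'⟩ := hy
    refine ⟨E ∪ E', fun e he => ?_⟩
    rw [Finset.mem_union, not_or] at he
    rw [map_add, hE e he.1, hE' e he.2, add_zero]
  | homog e v hv =>
    exact ⟨{e}, fun f hf => strand_homog_of_ne b m (by simpa using hf) v⟩

theorem strand_sum_homog (E : Finset (σ → ℤ)) (w : (σ → ℤ) → ι →₀ 𝕜)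
    (hw : ∀ e, w e ∈ lower 𝕜 m e) (hE : ∀ e, e ∉ E → w e = 0) (f : σ → ℤ) :
    strand b m f (∑ e ∈ E, homog b m e (w e)) = w f := by
  rw [map_sum]
  by_cases hf : f ∈ E
  · rw [Finset.sum_eq_single_of_mem f hf fun e _ he => strand_homog_of_ne b m he.symm _,
      strand_homog b m (hw f)]
  · rw [hE f hf]
    refine Finset.sum_eq_zero fun e he => strand_homog_of_ne b m ?_ _
    rintro rfl
    exact hf he

variable {b m}

theorem map_homog {φ : F →ₗ[MvPolynomial σ 𝕜] F} {D : (ι →₀ 𝕜) →ₗ[𝕜] (ι →₀ 𝕜)}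
    (hD : ∀ g, D (Finsupp.single g 1) ∈ lower 𝕜 m (m g))
    (hφ : ∀ g, φ (b g) = homog b m (m g) (D (Finsupp.single g 1)))
    {e : σ → ℤ} {v : ι →₀ 𝕜} (hv : v ∈ lower 𝕜 m e) :
    φ (homog b m e v) = homog b m e (D v) := by
  refine lower_induction (p := fun v => φ (homog b m e v) = homog b m e (D v)) ?_ (by simp)
    ?_ ?_ hv
  · intro g hg
    obtain ⟨u, hu⟩ := exists_toMultidegree_eq (sub_nonneg.2 hg)
    obtain rfl : toMultidegree u + m g = e := by rw [hu, sub_add_cancel]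
    rw [homog_single_toMultidegree, map_smul, hφ, monomial_smul_homog b m u (hD g)]
  · intro v w hv hw
    simp only [map_add, hv, hw]
  · intro c v hv
    rw [map_smul, φ.map_smul_of_tower, hv, map_smul, map_smul]

/-- A map of multidegree zero acts on all strands by one and the same matrix; this is what reduces
statements on `F` to linear algebra over `𝕜`. -/
theorem strand_map {φ : F →ₗ[MvPolynomial σ 𝕜] F} {D : (ι →₀ 𝕜) →ₗ[𝕜] (ι →₀ 𝕜)}
    (hD : ∀ g, D (Finsupp.single g 1) ∈ lower 𝕜 m (m g))
    (hφ : ∀ g, φ (b g) = homog b m (m g) (D (Finsupp.single g 1))) (e : σ → ℤ) (x : F) :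
    strand b m e (φ x) = D (strand b m e x) := by
  induction x using homog_induction (b := b) m with
  | zero => simp
  | add x y hx hy => simp only [map_add, hx, hy]
  | homog f v hv =>
    rw [map_homog hD hφ hv]
    by_cases h : e = f
    · subst h
      rw [strand_homog b m hv, strand_homog b m (map_mem_lower hD hv)]
    · rw [strand_homog_of_ne b m h, strand_homog_of_ne b m h, map_zero]

theorem map_homog₂ {μ : F →ₗ[MvPolynomial σ 𝕜] F →ₗ[MvPolynomial σ 𝕜] F}
    {M : (ι →₀ 𝕜) →ₗ[𝕜] (ι →₀ 𝕜) →ₗ[𝕜] (ι →₀ 𝕜)}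
    (hM : ∀ g h, M (Finsupp.single g 1) (Finsupp.single h 1) ∈ lower 𝕜 m (m g + m h))
    (hμ : ∀ g h, μ (b g) (b h) =
      homog b m (m g + m h) (M (Finsupp.single g 1) (Finsupp.single h 1)))
    {e f : σ → ℤ} {v w : ι →₀ 𝕜} (hv : v ∈ lower 𝕜 m e) (hw : w ∈ lower 𝕜 m f) :
    μ (homog b m e v) (homog b m f w) = homog b m (e + f) (M v w) := by
  refine lower_induction (p := fun v => μ (homog b m e v) (homog b m f w) =
    homog b m (e + f) (M v w)) ?_ (by simp) ?_ ?_ hv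
  · intro g hg
    refine lower_induction (p := fun w => μ (homog b m e (Finsupp.single g 1)) (homog b m f w) =
      homog b m (e + f) (M (Finsupp.single g 1) w)) ?_ (by simp) ?_ ?_ hw
    · intro h hh
      obtain ⟨u, hu⟩ := exists_toMultidegree_eq (sub_nonneg.2 hg)
      obtain rfl : toMultidegree u + m g = e := by rw [hu, sub_add_cancel]
      obtain ⟨t, ht⟩ := exists_toMultidegree_eq (sub_nonneg.2 hh)
      obtain rfl : toMultidegree t + m h = f := by rw [ht, sub_add_cancel]
      rw [homog_single_toMultidegree, homog_single_toMultidegree, map_smul, map_smul,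
        LinearMap.smul_apply, hμ, smul_smul, monomial_mul, mul_one,
        monomial_smul_homog b m _ (hM g h), toMultidegree_add]
      congr 2
      abel
    · intro v w hv hw
      simp only [map_add, hv, hw]
    · intro c v hv
      rw [map_smul, LinearMap.map_smul_of_tower, hv, map_smul, map_smul]
  · intro v w hv hw
    simp only [map_add, LinearMap.add_apply, hv, hw]
  · intro c v hv
    rw [map_smul, μ.map_smul_of_tower, LinearMap.smul_apply, hv, map_smul, LinearMap.smul_apply,
      map_smul]

end Strand

/-! ### Minimality as vanishing of constant terms -/

section VariableIdeal

variable {𝕜 σ ι F : Type*} [Field 𝕜] [AddCommGroup F] [Module (MvPolynomial σ 𝕜) F]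

theorem coeff_zero_repr_of_mem (b : Module.Basis ι (MvPolynomial σ 𝕜) F) {x : F}
    (hx : x ∈ Ideal.span (Set.range (X : σ → MvPolynomial σ 𝕜)) •
      (⊤ : Submodule (MvPolynomial σ 𝕜) F)) (g : ι) : (b.repr x g).coeff 0 = 0 := by
  have hX : Ideal.span (Set.range (X : σ → MvPolynomial σ 𝕜)) ≤
      RingHom.ker (constantCoeff : MvPolynomial σ 𝕜 →+* 𝕜) := by
    rw [Ideal.span_le]
    rintro _ ⟨s, rfl⟩
    simp
  rw [← constantCoeff_eq]
  induction hx using Submodule.smul_induction_on' with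
  | smul r hr n _ =>
    rw [map_smul, Finsupp.smul_apply, smul_eq_mul, map_mul, (RingHom.mem_ker).1 (hX hr), zero_mul]
  | add x _ y _ hx hy => rw [map_add, Finsupp.add_apply, map_add, hx, hy, add_zero]

theorem mem_of_coeff_zero_repr (b : Module.Basis ι (MvPolynomial σ 𝕜) F) {x : F}
    (hx : ∀ g, (b.repr x g).coeff 0 = 0) :
    x ∈ Ideal.span (Set.range (X : σ → MvPolynomial σ 𝕜)) •
      (⊤ : Submodule (MvPolynomial σ 𝕜) F) := by
  rw [← b.linearCombination_repr x, Finsupp.linearCombination_apply]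
  refine Submodule.sum_mem _ fun g _ => Submodule.smul_mem_smul ?_ trivial
  rw [← Set.image_univ, mem_ideal_span_X_image]
  intro u hu
  by_contra! h
  have : u = 0 := by
    ext s
    simpa using h s
  subst this
  exact mem_support_iff.1 hu (hx g)

end VariableIdeal

/-! ### From a resolution to its frame -/

/-- The axioms satisfied by the structure constants `D` of the differential of a multigraded minimal
free resolution of `S/I` and by the coordinate vector `v₀` of `1 ∈ F_0`. -/
structure IsFrame {𝕜 σ ι : Type*} [Field 𝕜] (I : Ideal (MvPolynomial σ 𝕜)) (hd : ι → ℕ)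
    (m : ι → σ → ℤ) (D : (ι →₀ 𝕜) →ₗ[𝕜] (ι →₀ 𝕜)) (v₀ : ι →₀ 𝕜) : Prop where
  lower : ∀ g, D (Finsupp.single g 1) ∈ lower 𝕜 m (m g)
  level_succ : ∀ i, ∀ v ∈ level 𝕜 hd (i + 1), D v ∈ level 𝕜 hd i
  level_zero : ∀ v ∈ level 𝕜 hd 0, D v = 0
  sq : ∀ v, D (D v) = 0
  minimal : ∀ g h, m g = m h → D (Finsupp.single g 1) h = 0
  exact : ∀ e i, ∀ v ∈ _root_.lower 𝕜 m e, v ∈ level 𝕜 hd (i + 1) → D v = 0 →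
    ∃ w ∈ _root_.lower 𝕜 m e, w ∈ level 𝕜 hd (i + 2) ∧ D w = v
  one : ∃ g₀ a, a ≠ 0 ∧ v₀ = Finsupp.single g₀ a ∧ m g₀ = 0 ∧ ∀ g, hd g = 0 ↔ g = g₀
  augmentation : ∀ u, monomial u (1 : 𝕜) ∈ I ↔
    ∃ w ∈ _root_.lower 𝕜 m (toMultidegree u), w ∈ level 𝕜 hd 1 ∧ D w = v₀

theorem IsFrame.one_mem_lower {𝕜 σ ι : Type*} [Field 𝕜] {I : Ideal (MvPolynomial σ 𝕜)}
    {hd : ι → ℕ} {m : ι → σ → ℤ} {D : (ι →₀ 𝕜) →ₗ[𝕜] (ι →₀ 𝕜)} {v₀ : ι →₀ 𝕜}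
    (h : IsFrame I hd m D v₀) : v₀ ∈ _root_.lower 𝕜 m 0 := by
  obtain ⟨g₀, a, -, rfl, h0, -⟩ := h.one
  exact single_mem_lower h0.le a

theorem level_le_comap {𝕜 ι : Type*} [Field 𝕜] {hd : ι → ℕ} {i : ℕ}
    {D : (ι →₀ 𝕜) →ₗ[𝕜] (ι →₀ 𝕜)} {N : Submodule 𝕜 (ι →₀ 𝕜)}
    (h : ∀ g, hd g = i → D (Finsupp.single g 1) ∈ N) : level 𝕜 hd i ≤ N.comap D := by
  rw [level, Finsupp.supported_eq_span_single, Submodule.span_le]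
  rintro _ ⟨g, hg, rfl⟩
  exact h g hg

namespace BasedComplex

theorem basis_mem_hpart {𝕜 σ ι F : Type*} [Field 𝕜] [AddCommGroup F] [Module (MvPolynomial σ 𝕜) F]
    {C : BasedComplex 𝕜 σ ι F} {g : ι} {i : ℕ} (h : C.hdeg g = i) : C.basis g ∈ C.hpart i :=
  Submodule.subset_span ⟨g, h, rfl⟩

section

variable {𝕜 σ ι F : Type*} [Field 𝕜] [Finite σ] [AddCommGroup F] [Module (MvPolynomial σ 𝕜) F]
  [Module 𝕜 F] [IsScalarTower 𝕜 (MvPolynomial σ 𝕜) F] {I : Ideal (MvPolynomial σ 𝕜)}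

/-- The endomorphism of `𝕜^ι` given by the structure constants of the differential. -/
def frame (C : BasedComplex 𝕜 σ ι F) : (ι →₀ 𝕜) →ₗ[𝕜] (ι →₀ 𝕜) :=
  Finsupp.linearCombination 𝕜 fun g => strand C.basis C.mdeg (C.mdeg g) (C.d (C.basis g))

variable (C : BasedComplex 𝕜 σ ι F)

theorem frame_single (g : ι) : C.frame (Finsupp.single g 1) =
    strand C.basis C.mdeg (C.mdeg g) (C.d (C.basis g)) := by
  simp [frame]

theorem diffConst_eq_frame (g h : ι) : C.diffConst g h = C.frame (Finsupp.single g 1) h := by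
  rw [frame_single]; rfl

theorem frame_mem_lower (g : ι) : C.frame (Finsupp.single g 1) ∈ lower 𝕜 C.mdeg (C.mdeg g) := by
  rw [frame_single]
  exact strand_mem_lower _ _ _ _

variable {C}

theorem isMultihomogeneous_iff {e : σ → ℤ} {x : F} :
    C.IsMultihomogeneous e x ↔ ∀ f, f ≠ e → strand C.basis C.mdeg f x = 0 :=
  homogeneous_iff C.basis C.mdeg x e

theorem isMultihomogeneous_homog (e : σ → ℤ) (v : ι →₀ 𝕜) :
    C.IsMultihomogeneous e (homog C.basis C.mdeg e v) :=
  isMultihomogeneous_iff.2 fun _ hf => strand_homog_of_ne C.basis C.mdeg hf v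

theorem isMultihomogeneous_basis (g : ι) : C.IsMultihomogeneous (C.mdeg g) (C.basis g) := by
  have := isMultihomogeneous_homog (C := C) (C.mdeg g) (Finsupp.single g 1)
  rwa [homog_single_self] at this

theorem IsMultihomogeneous.eq_homog {e : σ → ℤ} {x : F} (hx : C.IsMultihomogeneous e x) :
    x = homog C.basis C.mdeg e (strand C.basis C.mdeg e x) :=
  eq_homog_strand (isMultihomogeneous_iff.1 hx)

theorem mem_hpart {i : ℕ} {x : F} :
    x ∈ C.hpart i ↔ ∀ e, strand C.basis C.mdeg e x ∈ level 𝕜 C.hdeg i := by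
  rw [hpart, C.basis.mem_span_image]
  constructor
  · intro h e
    rw [mem_level]
    intro g hg
    refine h (Finsupp.mem_support_iff.2 fun h0 => hg ?_)
    rw [strand_apply, h0, laurentCoeff_zero]
  · intro h g hg
    by_contra hne
    refine Finsupp.mem_support_iff.1 hg (laurentCoeff_ext (C.mdeg g) fun e => ?_)
    rw [← strand_apply, laurentCoeff_zero]
    by_contra h0
    exact hne (mem_level.1 (h e) g h0)

theorem homog_mem_hpart {i : ℕ} {v : ι →₀ 𝕜} (hv : v ∈ level 𝕜 C.hdeg i) (e : σ → ℤ) :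
    homog C.basis C.mdeg e v ∈ C.hpart i := by
  rw [hpart, C.basis.mem_span_image]
  intro g hg
  rw [Finset.mem_coe, Finsupp.mem_support_iff, repr_homog] at hg
  exact mem_level.1 hv g fun h => hg (by rw [h, map_zero])

namespace IsMinimalFreeResolution

theorem d_basis (hC : C.IsMinimalFreeResolution I) (g : ι) : C.d (C.basis g) =
    homog C.basis C.mdeg (C.mdeg g) (C.frame (Finsupp.single g 1)) := by
  rw [frame_single]
  exact (hC.d_multihomogeneous _ _ (isMultihomogeneous_basis g)).eq_homog

theorem d_homog (hC : C.IsMinimalFreeResolution I) {e : σ → ℤ} {v : ι →₀ 𝕜}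
    (hv : v ∈ lower 𝕜 C.mdeg e) :
    C.d (homog C.basis C.mdeg e v) = homog C.basis C.mdeg e (C.frame v) :=
  map_homog C.frame_mem_lower hC.d_basis hv

theorem strand_d (hC : C.IsMinimalFreeResolution I) (e : σ → ℤ) (x : F) :
    strand C.basis C.mdeg e (C.d x) = C.frame (strand C.basis C.mdeg e x) :=
  strand_map C.frame_mem_lower hC.d_basis e x

theorem one_eq_homog (hC : C.IsMinimalFreeResolution I) :
    C.one = homog C.basis C.mdeg 0 (strand C.basis C.mdeg 0 C.one) :=
  hC.one_multihomogeneous.eq_homog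

/-- All of `F_0` consists of multiples of `one`, so over a domain it has a single basis element
`g₀`. The coordinate of `one` at `g₀` is invertible, which forces `g₀` to have multidegree zero. -/
theorem strand_one (hC : C.IsMinimalFreeResolution I) :
    ∃ g₀ a, a ≠ 0 ∧ strand C.basis C.mdeg 0 C.one = Finsupp.single g₀ a ∧ C.mdeg g₀ = 0 ∧
      ∀ g, C.hdeg g = 0 ↔ g = g₀ := by
  set v₀ := strand C.basis C.mdeg 0 C.one with hv₀
  have one_mem : C.one ∈ C.hpart 0 := by
    rw [hC.hpart_zero]; exact Submodule.mem_span_singleton_self _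
  have hlevel : v₀ ∈ level 𝕜 C.hdeg 0 := mem_hpart.1 one_mem 0
  have hv₀_ne : v₀ ≠ 0 := by
    intro h
    have h1 : C.one = 0 := by rw [hC.one_eq_homog, ← hv₀, h, map_zero]
    have := @hC.smul_one_injective 1 0 (by simp [h1])
    exact one_ne_zero this
  have hgen : ∀ g, C.hdeg g = 0 → ∃ r : MvPolynomial σ 𝕜, r • C.one = C.basis g := by
    intro g hg
    have := basis_mem_hpart hg
    rwa [hC.hpart_zero, Submodule.mem_span_singleton] at this
  have hrepr : ∀ g, C.basis.repr C.one g = laurentMonomial 𝕜 (0 - C.mdeg g) (v₀ g) := by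
    intro g
    conv_lhs => rw [hC.one_eq_homog]
    rw [repr_homog]
  have hunit : ∀ g (r : MvPolynomial σ 𝕜), r • C.one = C.basis g →
      r * C.basis.repr C.one g = 1 := by
    intro g r hr
    have := congrArg (fun x => C.basis.repr x g) hr
    simpa using this
  obtain ⟨g₀, hg₀⟩ := Finsupp.ne_iff.1 hv₀_ne
  rw [Finsupp.zero_apply] at hg₀
  have hd₀ : C.hdeg g₀ = 0 := mem_level.1 hlevel g₀ hg₀
  have huniq : ∀ g, C.hdeg g = 0 → g = g₀ := by
    intro g hg
    by_contra hne
    obtain ⟨r, hr⟩ := hgen g hg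
    obtain ⟨r', hr'⟩ := hgen g₀ hd₀
    have h1 := hunit g r hr
    have h2 := hunit g₀ r' hr'
    have h3 : r * C.basis.repr C.one g₀ = 0 := by
      have := congrArg (fun x => C.basis.repr x g₀) hr
      simpa [hne] using this
    rcases mul_eq_zero.1 h3 with h | h
    · rw [h, zero_mul] at h1; exact zero_ne_one h1
    · rw [h, mul_zero] at h2; exact zero_ne_one h2
  refine ⟨g₀, v₀ g₀, hg₀, ?_, ?_, fun g => ⟨huniq g, fun h => h ▸ hd₀⟩⟩
  · ext g
    by_cases hg : g = g₀
    · subst hg; simp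
    · rw [Finsupp.single_eq_of_ne hg]
      by_contra h
      exact hg (huniq g (mem_level.1 hlevel g h))
  -- The coordinate of `one` at `g₀` divides 1, so its constant term is non-zero; a Laurent monomial
  -- has a constant term only if its exponent is zero.
  · obtain ⟨r, hr⟩ := hgen g₀ hd₀
    have h1 := congrArg (constantCoeff (R := 𝕜)) (hunit g₀ r hr)
    rw [map_mul, map_one, hrepr] at h1
    by_contra hne
    have h2 := laurentCoeff_laurentMonomial_of_ne (f := (0 : σ → ℤ)) (e := 0 - C.mdeg g₀)
      (by simpa [eq_comm] using hne) (v₀ g₀)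
    rw [← toMultidegree_zero, laurentCoeff_toMultidegree] at h2
    rw [toMultidegree_zero, ← constantCoeff_eq] at h2
    rw [h2, mul_zero] at h1
    exact zero_ne_one h1

theorem isFrame (hC : C.IsMinimalFreeResolution I) :
    IsFrame I C.hdeg C.mdeg C.frame (strand C.basis C.mdeg 0 C.one) where
  lower := C.frame_mem_lower
  level_succ i := by
    have : level 𝕜 C.hdeg (i + 1) ≤ (level 𝕜 C.hdeg i).comap C.frame :=
      level_le_comap fun g hg => by
        rw [frame_single]
        exact mem_hpart.1 (hC.d_mem i _ (basis_mem_hpart hg)) _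
    exact fun v hv => this hv
  level_zero := by
    have : level 𝕜 C.hdeg 0 ≤ (⊥ : Submodule 𝕜 (ι →₀ 𝕜)).comap C.frame :=
      level_le_comap fun g hg => by
        rw [frame_single, hC.d_zero _ (basis_mem_hpart hg), map_zero]
        exact zero_mem _
    exact fun v hv => this hv
  sq v := by
    have : C.frame ∘ₗ C.frame = 0 := by
      ext g : 2
      rw [LinearMap.comp_apply, LinearMap.comp_apply, Finsupp.lsingle_apply, C.frame_single,
        ← hC.strand_d, hC.d_comp_d, map_zero]
      rfl
    exact LinearMap.congr_fun this v
  minimal g h hgh := by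
    rw [frame_single, strand_apply, hgh, sub_self, ← toMultidegree_zero,
      laurentCoeff_toMultidegree]
    exact coeff_zero_repr_of_mem C.basis (hC.minimal _) h
  exact e i v hv hvi hDv := by
    obtain ⟨y, hy, hdy⟩ := hC.exact i (homog C.basis C.mdeg e v) (homog_mem_hpart hvi e)
      (by rw [hC.d_homog hv, hDv, map_zero])
    refine ⟨strand C.basis C.mdeg e y, strand_mem_lower _ _ _ _, mem_hpart.1 hy e, ?_⟩
    rw [← hC.strand_d, hdy, strand_homog _ _ hv]
  one := hC.strand_one
  augmentation u := by
    have h0 := strand_mem_lower C.basis C.mdeg 0 C.one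
    have h1 : monomial u (1 : 𝕜) • C.one =
        homog C.basis C.mdeg (toMultidegree u) (strand C.basis C.mdeg 0 C.one) := by
      conv_lhs => rw [hC.one_eq_homog]
      rw [monomial_smul_homog _ _ _ h0, add_zero]
    rw [← hC.smul_one_mem, h1]
    constructor
    · rintro ⟨y, hy, hdy⟩
      refine ⟨strand C.basis C.mdeg (toMultidegree u) y, strand_mem_lower _ _ _ _,
        mem_hpart.1 hy _, ?_⟩
      rw [← hC.strand_d, hdy, strand_homog _ _ (lower_mono _ (toMultidegree_nonneg u) h0)]
    · rintro ⟨w, hw, hw1, hDw⟩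
      exact ⟨_, homog_mem_hpart hw1 (toMultidegree u), by rw [hC.d_homog hw, hDw]⟩

end IsMinimalFreeResolution

end

/-! ### From a frame back to a resolution -/

section OfFrame

variable {𝕜 σ ι : Type*} [Field 𝕜] [Finite σ]

/-- The complex with homological degrees `hd`, multidegrees `m`, and structure constants `D`. -/
def ofFrame (hd : ι → ℕ) (m : ι → σ → ℤ) (D : (ι →₀ 𝕜) →ₗ[𝕜] (ι →₀ 𝕜)) (v₀ : ι →₀ 𝕜) :
    BasedComplex 𝕜 σ ι (ι →₀ MvPolynomial σ 𝕜) where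
  basis := Finsupp.basisSingleOne
  hdeg := hd
  mdeg := m
  d := Finsupp.basisSingleOne.constr (MvPolynomial σ 𝕜) fun g =>
    homog Finsupp.basisSingleOne m (m g) (D (Finsupp.single g 1))
  one := homog Finsupp.basisSingleOne m 0 v₀

variable {hd : ι → ℕ} {m : ι → σ → ℤ} {D : (ι →₀ 𝕜) →ₗ[𝕜] (ι →₀ 𝕜)} {v₀ : ι →₀ 𝕜}

theorem ofFrame_d_basis (g : ι) : (ofFrame hd m D v₀).d ((ofFrame hd m D v₀).basis g) =
    homog (ofFrame hd m D v₀).basis m (m g) (D (Finsupp.single g 1)) :=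
  Module.Basis.constr_basis _ _ _ _

theorem frame_ofFrame (hD : ∀ g, D (Finsupp.single g 1) ∈ lower 𝕜 m (m g)) :
    (ofFrame hd m D v₀).frame = D := by
  ext g : 2
  rw [LinearMap.comp_apply, LinearMap.comp_apply, Finsupp.lsingle_apply, frame_single,
    ofFrame_d_basis]
  exact strand_homog _ _ (hD g)

theorem isMinimalFreeResolution_ofFrame {I : Ideal (MvPolynomial σ 𝕜)} (hI : IsMonomialIdeal I)
    (h : IsFrame I hd m D v₀) : (ofFrame hd m D v₀).IsMinimalFreeResolution I := by
  obtain ⟨g₀, a, ha, hv₀, hm₀, hd₀⟩ := h.one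
  set C := ofFrame hd m D v₀ with hC
  have strand_d (e : σ → ℤ) (x) : strand C.basis m e (C.d x) = D (strand C.basis m e x) :=
    strand_map h.lower ofFrame_d_basis e x
  have d_homog {e : σ → ℤ} {v : ι →₀ 𝕜} (hv : v ∈ lower 𝕜 m e) :
      C.d (homog C.basis m e v) = homog C.basis m e (D v) :=
    map_homog h.lower ofFrame_d_basis hv
  have one_eq : C.one = (MvPolynomial.C a : MvPolynomial σ 𝕜) • C.basis g₀ := by
    have := homog_single_toMultidegree C.basis m 0 g₀ a
    rw [toMultidegree_zero, hm₀, add_zero, ← hv₀] at this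
    exact this
  have haU : IsUnit (MvPolynomial.C a : MvPolynomial σ 𝕜) := (isUnit_iff_ne_zero.2 ha).map _
  have repr_smul_one (r : MvPolynomial σ 𝕜) (g : ι) :
      C.basis.repr (r • C.one) g = Finsupp.single g₀ (r * MvPolynomial.C a) g := by
    rw [one_eq, smul_smul, map_smul, Module.Basis.repr_self, Finsupp.smul_single, smul_eq_mul,
      mul_one]
  have smul_one (u : σ →₀ ℕ) : monomial u (1 : 𝕜) • C.one =
      homog C.basis m (toMultidegree u) v₀ := by
    have := monomial_smul_homog C.basis m u h.one_mem_lower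
    rwa [add_zero] at this
  constructor
  · intro i x hx
    refine mem_hpart.2 fun e => ?_
    change strand C.basis m e (C.d x) ∈ _
    rw [strand_d]
    exact h.level_succ i _ (mem_hpart.1 hx e)
  · intro x hx
    refine strand_ext (b := C.basis) m fun e => ?_
    rw [strand_d, map_zero]
    exact h.level_zero _ (mem_hpart.1 hx e)
  · intro e x hx
    refine isMultihomogeneous_iff.2 fun f hf => ?_
    change strand C.basis m f (C.d x) = 0
    have := isMultihomogeneous_iff.1 hx f hf
    rw [strand_d, show strand C.basis m f x = 0 from this, map_zero]
  · intro x
    refine strand_ext (b := C.basis) m fun e => ?_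
    rw [strand_d, strand_d, h.sq, map_zero]
  · intro i x hx hdx
    obtain ⟨E, hE⟩ := exists_finset_strand_eq_zero C.basis m x
    have hex : ∀ e, ∃ w ∈ lower 𝕜 m e, w ∈ level 𝕜 hd (i + 2) ∧ D w = strand C.basis m e x :=
      fun e => h.exact e i _ (strand_mem_lower _ _ _ _) (mem_hpart.1 hx e)
        (by rw [← strand_d, hdx, map_zero])
    choose w hw hwi hDw using hex
    -- Only finitely many strands of `x` are non-zero, so preimages chosen strand by strand add up
    -- to a preimage of `x`.
    refine ⟨∑ e ∈ E, homog C.basis m e (w e),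
      Submodule.sum_mem _ fun e _ => homog_mem_hpart (hwi e) e, ?_⟩
    refine strand_ext (b := C.basis) m fun f => ?_
    rw [map_sum, Finset.sum_congr rfl fun e _ => d_homog (hw e), strand_sum_homog, hDw]
    · exact fun e => map_mem_lower h.lower (hw e)
    · exact fun e he => by rw [hDw, hE e he]
  · exact isMultihomogeneous_homog (C := C) 0 v₀
  · have : {g | C.hdeg g = 0} = {g₀} := Set.ext hd₀
    rw [hpart, this, Set.image_singleton, one_eq, Submodule.span_singleton_smul_eq haU]
  · intro r s hrs
    have := congrArg (fun x => C.basis.repr x g₀) hrs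
    simp only [repr_smul_one, Finsupp.single_eq_same] at this
    exact haU.mul_right_cancel this
  · intro r
    constructor
    · rintro ⟨y, hy, hdy⟩
      rw [← support_sum_monomial_coeff r]
      refine Ideal.sum_mem _ fun u hu => ?_
      have hc : r.coeff u ≠ 0 := mem_support_iff.1 hu
      have key : D (strand C.basis m (toMultidegree u) y) = r.coeff u • v₀ := by
        rw [← strand_d, hdy, hv₀]
        ext g
        rw [strand_apply, repr_smul_one, Finsupp.smul_apply]
        by_cases hg : g = g₀
        · subst hg
          rw [Finsupp.single_eq_same, Finsupp.single_eq_same, hm₀, sub_zero,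
            laurentCoeff_toMultidegree, mul_comm, coeff_C_mul, smul_eq_mul, mul_comm]
        · rw [Finsupp.single_eq_of_ne hg, Finsupp.single_eq_of_ne hg, laurentCoeff_zero, smul_zero]
      -- The strand of `y` at `u` maps to `r.coeff u • v₀`; dividing by the coefficient gives the
      -- witness for the augmentation axiom.
      have hu : monomial u (1 : 𝕜) ∈ I := by
        refine (h.augmentation u).2 ⟨(r.coeff u)⁻¹ • strand C.basis m (toMultidegree u) y,
          Submodule.smul_mem _ _ (strand_mem_lower _ _ _ _),
          Submodule.smul_mem _ _ (mem_hpart.1 hy _), ?_⟩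
        rw [map_smul, key, smul_smul, inv_mul_cancel₀ hc, one_smul]
      have := I.mul_mem_left (MvPolynomial.C (r.coeff u)) hu
      rwa [C_mul_monomial, mul_one] at this
    -- The `r` for which `r • one` is a boundary from `F_1` form an ideal, and `I` is generated by
    -- monomials, so monomials suffice.
    · have hle : I ≤ ((C.hpart 1).map C.d).comap
          (LinearMap.toSpanSingleton (MvPolynomial σ 𝕜) _ C.one) := by
        have hsub : ∀ u, monomial u (1 : 𝕜) ∈ I → monomial u (1 : 𝕜) ∈
            ((C.hpart 1).map C.d).comap
              (LinearMap.toSpanSingleton (MvPolynomial σ 𝕜) _ C.one) := by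
          intro u hu
          obtain ⟨w, hw, hw1, hDw⟩ := (h.augmentation u).1 hu
          refine ⟨_, homog_mem_hpart (C := C) hw1 (toMultidegree u), ?_⟩
          rw [LinearMap.toSpanSingleton_apply, smul_one, ← hDw]
          exact d_homog hw
        obtain ⟨A, hA⟩ := hI
        conv_lhs => rw [hA]
        refine Submodule.span_le.2 ?_
        rintro _ ⟨u, hu, rfl⟩
        exact hsub u (by rw [hA]; exact Ideal.subset_span ⟨u, hu, rfl⟩)
      intro hr
      exact hle hr
  · intro x
    rw [← C.basis.linearCombination_repr x, Finsupp.linearCombination_apply, Finsupp.sum, map_sum]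
    refine Submodule.sum_mem _ fun g _ => ?_
    rw [map_smul]
    refine Submodule.smul_mem _ _ (mem_of_coeff_zero_repr C.basis fun f => ?_)
    rw [show C.d (C.basis g) = _ from ofFrame_d_basis g, repr_homog, ← laurentCoeff_toMultidegree,
      toMultidegree_zero]
    by_cases hgf : m g = m f
    · rw [h.minimal g f hgf, map_zero, laurentCoeff_zero]
    · exact laurentCoeff_laurentMonomial_of_ne (Ne.symm (sub_ne_zero.2 hgf)) _

end OfFrame

end BasedComplex

/-! ### The lcm-lattice -/

section LcmLattice

variable {𝕜 σ : Type*} [Field 𝕜] {I : Ideal (MvPolynomial σ 𝕜)}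

theorem monomial_mem_of_le {u v : σ →₀ ℕ} (h : u ≤ v) (hu : monomial u (1 : 𝕜) ∈ I) :
    monomial v (1 : 𝕜) ∈ I := by
  have := I.mul_mem_left (monomial (v - u) (1 : 𝕜)) hu
  rwa [monomial_mul, tsub_add_cancel_of_le h, one_mul] at this

theorem zero_mem_lcmLattice : (0 : σ →₀ ℕ) ∈ lcmLattice I := ⟨∅, by simp, rfl⟩

theorem sup_mem_lcmLattice {u v : σ →₀ ℕ} (hu : u ∈ lcmLattice I) (hv : v ∈ lcmLattice I) :
    u ⊔ v ∈ lcmLattice I := by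
  classical
  obtain ⟨W, hW, rfl⟩ := hu
  obtain ⟨W', hW', rfl⟩ := hv
  exact ⟨W ∪ W', by simp [hW, hW'], Finset.sup_union⟩

theorem minimalGenerators_subset_lcmLattice : minimalGenerators I ⊆ lcmLattice I :=
  fun u hu => ⟨{u}, by simpa using hu, by simp⟩

theorem monomial_mem_iff_of_mem_lcmLattice (hI : I ≠ ⊤) {w : σ →₀ ℕ} (hw : w ∈ lcmLattice I) :
    monomial w (1 : 𝕜) ∈ I ↔ w ≠ 0 := by
  constructor
  · rintro h rfl
    exact hI ((Ideal.eq_top_iff_one I).2 h)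
  · intro h
    obtain ⟨W, hW, rfl⟩ := hw
    obtain ⟨v, hv⟩ : W.Nonempty := by
      rw [Finset.nonempty_iff_ne_empty]
      rintro rfl
      exact h rfl
    have hv' : Minimal (fun u : σ →₀ ℕ => monomial u (1 : 𝕜) ∈ I) v := hW hv
    exact monomial_mem_of_le (Finset.le_sup (f := id) hv) hv'.prop

/-- The greatest element is the join of the finitely many minimal generators below `u`. If `x^u ∈
I`, one of these divides it, and hence divides the monomial of the join. -/
theorem exists_greatest_lcmLattice_le [Finite σ] (I : Ideal (MvPolynomial σ 𝕜)) (u : σ →₀ ℕ) :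
    ∃ w ∈ lcmLattice I, w ≤ u ∧ (∀ v ∈ lcmLattice I, v ≤ u → v ≤ w) ∧
      (monomial u (1 : 𝕜) ∈ I ↔ monomial w (1 : 𝕜) ∈ I) := by
  classical
  have hfin : {v ∈ minimalGenerators I | v ≤ u}.Finite :=
    (Set.finite_Iic u).subset fun v hv => hv.2
  have hle : hfin.toFinset.sup id ≤ u :=
    Finset.sup_le fun v hv => ((hfin.mem_toFinset).1 hv).2
  have hmem : hfin.toFinset.sup id ∈ lcmLattice I :=
    ⟨hfin.toFinset, fun v hv => ((hfin.mem_toFinset).1 hv).1, rfl⟩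
  have hmax : ∀ v ∈ lcmLattice I, v ≤ u → v ≤ hfin.toFinset.sup id := by
    rintro _ ⟨W, hW, rfl⟩ hv
    refine Finset.sup_mono fun x hx => (hfin.mem_toFinset).2 ⟨hW hx, ?_⟩
    exact (Finset.le_sup (f := id) hx).trans hv
  refine ⟨_, hmem, hle, hmax, fun h => ?_, monomial_mem_of_le hle⟩
  obtain ⟨v, hvu, hv⟩ := exists_minimal_le_of_wellFoundedLT
    (fun v : σ →₀ ℕ => monomial v (1 : 𝕜) ∈ I) u h
  exact monomial_mem_of_le (hmax v (minimalGenerators_subset_lcmLattice hv) hvu) hv.prop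

end LcmLattice

/-! ### Multidegrees of basis elements lie in the lcm-lattice -/

namespace IsFrame

variable {𝕜 σ ι : Type*} [Field 𝕜] {I : Ideal (MvPolynomial σ 𝕜)} {hd : ι → ℕ}
  {m : ι → σ → ℤ} {D : (ι →₀ 𝕜) →ₗ[𝕜] (ι →₀ 𝕜)} {v₀ : ι →₀ 𝕜}

/-- If `g` occurs in `D f` with `m f ≤ m g`, then also `m g ≤ m f`, and minimality excludes equal
multidegrees. So `g` cannot be part of a boundary coming from `lower` at `m g`. -/
theorem apply_eq_zero (h : IsFrame I hd m D v₀) {g : ι} {w : ι →₀ 𝕜}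
    (hw : w ∈ _root_.lower 𝕜 m (m g)) : D w g = 0 := by
  refine lower_induction (p := fun w => D w g = 0) ?_ (by simp) ?_ ?_ hw
  · intro f hf
    by_contra hne
    exact hne (h.minimal f g (le_antisymm hf (mem_lower.1 (h.lower f) g hne)))
  · intro v w hv hw
    rw [map_add, Finsupp.add_apply, hv, hw, add_zero]
  · intro c v hv
    rw [map_smul, Finsupp.smul_apply, hv, smul_zero]

/-- By induction, the multidegrees occurring in `z = D g` are lattice elements below `m g`, hence
below the greatest such element `w`. So `z` already bounds some `y` in `lower` at `w`. The cycle `g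
- y` is a boundary, so its coordinate at `g` vanishes; thus `g` occurs in `y`, and `m g ≤ w`. -/
theorem mdeg_mem_lcmLattice [Finite σ] (h : IsFrame I hd m D v₀) (g : ι) :
    ∃ w ∈ lcmLattice I, m g = toMultidegree w := by
  obtain ⟨g₀, a, ha, hv₀, hm₀, hd₀⟩ := h.one
  induction hi : hd g generalizing g with
  | zero =>
    rw [hd₀] at hi
    subst hi
    exact ⟨0, zero_mem_lcmLattice, by rw [hm₀, toMultidegree_zero]⟩
  | succ i ih =>
    set z := D (Finsupp.single g 1) with hz
    have hgl : Finsupp.single g (1 : 𝕜) ∈ _root_.lower 𝕜 m (m g) := single_mem_lower le_rfl 1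
    have hgi : Finsupp.single g (1 : 𝕜) ∈ level 𝕜 hd (i + 1) := single_mem_level hi 1
    have hzl : z ∈ _root_.lower 𝕜 m (m g) := h.lower g
    have hzi : z ∈ level 𝕜 hd i := h.level_succ i _ hgi
    -- If `D g` were zero, exactness would make `g` a boundary from `lower` at `m g`, against
    -- `apply_eq_zero`.
    have hz0 : z ≠ 0 := by
      intro hz0
      obtain ⟨w, hw, -, hDw⟩ := h.exact (m g) i _ hgl hgi hz0
      have := h.apply_eq_zero hw
      rw [hDw, Finsupp.single_eq_same] at this
      exact one_ne_zero this
    obtain ⟨f, hf⟩ := Finsupp.ne_iff.1 hz0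
    have hg0 : 0 ≤ m g := by
      obtain ⟨w, -, hw⟩ := ih f (mem_level.1 hzi f hf)
      refine le_trans ?_ (mem_lower.1 hzl f hf)
      rw [hw]
      exact toMultidegree_nonneg w
    obtain ⟨u, hu⟩ := exists_toMultidegree_eq hg0
    obtain ⟨w, hwL, hwu, hwmax, hwI⟩ := exists_greatest_lcmLattice_le I u
    have hwg : toMultidegree w ≤ m g := by rw [← hu, toMultidegree_le]; exact hwu
    have hzw : z ∈ _root_.lower 𝕜 m (toMultidegree w) := by
      rw [mem_lower]
      intro f hf
      obtain ⟨t, htL, ht⟩ := ih f (mem_level.1 hzi f hf)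
      rw [ht, toMultidegree_le]
      refine hwmax t htL ?_
      rw [← toMultidegree_le, ← ht, hu]
      exact mem_lower.1 hzl f hf
    have hy : ∃ y ∈ _root_.lower 𝕜 m (toMultidegree w), y ∈ level 𝕜 hd (i + 1) ∧ D y = z := by
      cases i with
      | succ j => exact h.exact _ j z hzw hzi (h.sq _)
      -- The exactness axiom does not reach homological degree 0. Instead `z` is a non-zero multiple
      -- of `v₀`, so `x^u ∈ I`, hence `x^w ∈ I`, and the augmentation axiom at `w` provides `y`.
      | zero =>
        have hzv : z = (z g₀ * a⁻¹) • v₀ := by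
          ext f
          rw [hv₀, Finsupp.smul_apply, smul_eq_mul]
          by_cases hfg : f = g₀
          · subst hfg
            rw [Finsupp.single_eq_same, inv_mul_cancel_right₀ ha]
          · rw [Finsupp.single_eq_of_ne hfg, mul_zero]
            by_contra hne
            exact hfg ((hd₀ f).1 (mem_level.1 hzi f hne))
        have hc : z g₀ * a⁻¹ ≠ 0 := by
          intro hc
          rw [hc, zero_smul] at hzv
          exact hz0 hzv
        have huI : monomial u (1 : 𝕜) ∈ I := by
          refine (h.augmentation u).2 ⟨(z g₀ * a⁻¹)⁻¹ • Finsupp.single g 1,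
            Submodule.smul_mem _ _ (by rwa [hu]), Submodule.smul_mem _ _ hgi, ?_⟩
          rw [map_smul, ← hz]
          nth_rw 2 [hzv]
          rw [smul_smul, inv_mul_cancel₀ hc, one_smul]
        obtain ⟨y, hy, hy1, hDy⟩ := (h.augmentation w).1 (hwI.1 huI)
        exact ⟨(z g₀ * a⁻¹) • y, Submodule.smul_mem _ _ hy, Submodule.smul_mem _ _ hy1,
          by rw [map_smul, hDy, ← hzv]⟩
    obtain ⟨y, hyw, hyi, hDy⟩ := hy
    obtain ⟨x, hx, -, hDx⟩ := h.exact (m g) i (Finsupp.single g 1 - y)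
      (sub_mem hgl (lower_mono m hwg hyw)) (sub_mem hgi hyi)
      (by rw [map_sub, hDy, ← hz, sub_self])
    have h1 := h.apply_eq_zero hx
    rw [hDx, Finsupp.sub_apply, Finsupp.single_eq_same] at h1
    refine ⟨w, hwL, le_antisymm (mem_lower.1 hyw g ?_) hwg⟩
    rw [← sub_eq_zero.1 h1]
    exact one_ne_zero

end IsFrame

/-! ### Transport of frames along the lattice isomorphism -/

section Relabel

variable {𝕜 σ σ' ι : Type*} [Field 𝕜] {I : Ideal (MvPolynomial σ 𝕜)}
  {I' : Ideal (MvPolynomial σ' 𝕜)}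

/-- The multidegrees `m'` are the images of the multidegrees `m` under `ν`. -/
def IsDegreeRelabeling (ν : lcmLattice I ≃o lcmLattice I') (m : ι → σ → ℤ)
    (m' : ι → σ' → ℤ) : Prop :=
  ∀ g, ∃ w : lcmLattice I, m g = toMultidegree (w : σ →₀ ℕ) ∧
    m' g = toMultidegree (ν w : σ' →₀ ℕ)

theorem orderIso_eq_zero_iff (ν : lcmLattice I ≃o lcmLattice I') (w : lcmLattice I) :
    (ν w : σ' →₀ ℕ) = 0 ↔ (w : σ →₀ ℕ) = 0 := by
  constructor
  · intro h
    have h1 : ν w ≤ ν ⟨0, zero_mem_lcmLattice⟩ := by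
      rw [← Subtype.coe_le_coe, h]; exact zero_le
    exact le_antisymm (ν.le_iff_le.1 h1) zero_le
  · intro h
    have h1 : w ≤ ν.symm ⟨0, zero_mem_lcmLattice⟩ := by
      rw [← Subtype.coe_le_coe, h]; exact zero_le
    have h2 := ν.monotone h1
    rw [OrderIso.apply_symm_apply] at h2
    exact le_antisymm h2 zero_le

namespace IsDegreeRelabeling

variable {ν : lcmLattice I ≃o lcmLattice I'} {m : ι → σ → ℤ} {m' : ι → σ' → ℤ}

theorem nonneg (hm : IsDegreeRelabeling ν m m') (g : ι) : 0 ≤ m' g := by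
  obtain ⟨w, -, hw⟩ := hm g
  rw [hw]
  exact toMultidegree_nonneg _

theorem le_iff (hm : IsDegreeRelabeling ν m m') (g h : ι) : m' g ≤ m' h ↔ m g ≤ m h := by
  obtain ⟨w, hw, hw'⟩ := hm g
  obtain ⟨t, ht, ht'⟩ := hm h
  rw [hw, hw', ht, ht', toMultidegree_le, toMultidegree_le]
  exact ν.le_iff_le

theorem eq_zero_iff (hm : IsDegreeRelabeling ν m m') (g : ι) : m' g = 0 ↔ m g = 0 := by
  obtain ⟨w, hw, hw'⟩ := hm g
  rw [hw, hw', ← toMultidegree_zero, toMultidegree_injective.eq_iff, ← toMultidegree_zero,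
    toMultidegree_injective.eq_iff]
  exact orderIso_eq_zero_iff ν w

/-- Joins in the lcm-lattices are componentwise maxima, and an order isomorphism preserves joins. -/
theorem le_sup (hm : IsDegreeRelabeling ν m m') {f g h : ι} (hf : m f ≤ m g ⊔ m h) :
    m' f ≤ m' g ⊔ m' h := by
  obtain ⟨w, hw, hw'⟩ := hm f
  obtain ⟨t, ht, ht'⟩ := hm g
  obtain ⟨s, hs, hs'⟩ := hm h
  rw [hw, ht, hs, ← toMultidegree_sup, toMultidegree_le] at hf
  rw [hw', ht', hs', ← toMultidegree_sup, toMultidegree_le]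
  set r : lcmLattice I' := ⟨_, sup_mem_lcmLattice (ν t).2 (ν s).2⟩ with hr
  have h1 : t ≤ ν.symm r := by
    rw [OrderIso.le_symm_apply]
    exact (le_sup_left : (ν t : σ' →₀ ℕ) ≤ _)
  have h2 : s ≤ ν.symm r := by
    rw [OrderIso.le_symm_apply]
    exact (le_sup_right : (ν s : σ' →₀ ℕ) ≤ _)
  have h3 : w ≤ ν.symm r := hf.trans (sup_le (α := σ →₀ ℕ) h1 h2)
  rw [OrderIso.le_symm_apply] at h3
  exact h3

theorem lower_eq_bot (hm : IsDegreeRelabeling ν m m') {e : σ' → ℤ} (he : ¬ 0 ≤ e) {v : ι →₀ 𝕜}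
    (hv : v ∈ lower 𝕜 m' e) : v = 0 := by
  ext g
  by_contra hne
  exact he ((hm.nonneg g).trans (mem_lower.1 hv g hne))

/-- The witness `w` is the preimage under `ν` of the greatest element of `L_{I'}` below `u`.
Membership in the ideals agrees because, both being proper, it only asks whether a lattice element
is the bottom. -/
theorem exists_lower_eq [Finite σ'] (hm : IsDegreeRelabeling ν m m') (hI : I ≠ ⊤) (hI' : I' ≠ ⊤)
    (u : σ' →₀ ℕ) : ∃ w : σ →₀ ℕ,
      lower 𝕜 m' (toMultidegree u) = lower 𝕜 m (toMultidegree w) ∧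
      (monomial u (1 : 𝕜) ∈ I' ↔ monomial w (1 : 𝕜) ∈ I) := by
  obtain ⟨t, htL, htu, htmax, htI⟩ := exists_greatest_lcmLattice_le I' u
  obtain ⟨w, hw⟩ := ν.surjective ⟨t, htL⟩
  have hwt : (ν w : σ' →₀ ℕ) = t := congrArg Subtype.val hw
  refine ⟨w, ?_, ?_⟩
  · have : {g | m' g ≤ toMultidegree u} = {g | m g ≤ toMultidegree (w : σ →₀ ℕ)} := by
      ext g
      obtain ⟨s, hs, hs'⟩ := hm g
      rw [Set.mem_ofPred_eq, Set.mem_ofPred_eq, hs, hs', toMultidegree_le, toMultidegree_le]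
      rw [show (s : σ →₀ ℕ) ≤ w ↔ (ν s : σ' →₀ ℕ) ≤ ν w from ν.le_iff_le.symm, hwt]
      exact ⟨htmax _ (ν s).2, fun h => h.trans htu⟩
    rw [lower, lower, this]
  · rw [htI, monomial_mem_iff_of_mem_lcmLattice hI' htL, monomial_mem_iff_of_mem_lcmLattice hI w.2,
      ← hwt, Ne, orderIso_eq_zero_iff]

end IsDegreeRelabeling

theorem IsFrame.relabel [Finite σ'] {ν : lcmLattice I ≃o lcmLattice I'} {hd : ι → ℕ}
    {m : ι → σ → ℤ} {m' : ι → σ' → ℤ} {D : (ι →₀ 𝕜) →ₗ[𝕜] (ι →₀ 𝕜)} {v₀ : ι →₀ 𝕜}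
    (h : IsFrame I hd m D v₀) (hm : IsDegreeRelabeling ν m m') (hI : I ≠ ⊤) (hI' : I' ≠ ⊤) :
    IsFrame I' hd m' D v₀ where
  lower g := mem_lower.2 fun f hf => (hm.le_iff f g).2 (mem_lower.1 (h.lower g) f hf)
  level_succ := h.level_succ
  level_zero := h.level_zero
  sq := h.sq
  minimal f g hfg := h.minimal f g
    (le_antisymm ((hm.le_iff f g).1 hfg.le) ((hm.le_iff g f).1 hfg.ge))
  exact e i v hv hvi hDv := by
    by_cases he : 0 ≤ e
    · obtain ⟨u, rfl⟩ := exists_toMultidegree_eq he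
      obtain ⟨w, hw, -⟩ := hm.exists_lower_eq hI hI' u
      rw [hw] at hv ⊢
      exact h.exact _ i v hv hvi hDv
    -- All `m' g` are non-negative, so the strand at such an `e` is zero.
    · exact ⟨0, zero_mem _, zero_mem _, by rw [map_zero, hm.lower_eq_bot he hv]⟩
  one := by
    obtain ⟨g₀, a, ha, hv₀, hm₀, hd₀⟩ := h.one
    exact ⟨g₀, a, ha, hv₀, (hm.eq_zero_iff g₀).2 hm₀, hd₀⟩
  augmentation u := by
    obtain ⟨w, hw, hwI⟩ := hm.exists_lower_eq hI hI' u
    rw [hwI, hw]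
    exact h.augmentation w

end Relabel

/-! ### From a supportive multiplication to its frame -/

theorem map_mem_lower₂ {𝕜 σ ι : Type*} [Field 𝕜] {m : ι → σ → ℤ}
    {M : (ι →₀ 𝕜) →ₗ[𝕜] (ι →₀ 𝕜) →ₗ[𝕜] (ι →₀ 𝕜)} (s : (σ → ℤ) → (σ → ℤ) → σ → ℤ)
    (hs : ∀ a b c d, a ≤ b → c ≤ d → s a c ≤ s b d)
    (hM : ∀ g h, M (Finsupp.single g 1) (Finsupp.single h 1) ∈ lower 𝕜 m (s (m g) (m h)))
    {e f : σ → ℤ} {v w : ι →₀ 𝕜} (hv : v ∈ lower 𝕜 m e) (hw : w ∈ lower 𝕜 m f) :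
    M v w ∈ lower 𝕜 m (s e f) := by
  refine lower_induction (p := fun v => M v w ∈ lower 𝕜 m (s e f)) ?_ (by simp) ?_ ?_ hv
  · intro g hg
    refine lower_induction (p := fun w => M (Finsupp.single g 1) w ∈ lower 𝕜 m (s e f))
      ?_ (by simp) ?_ ?_ hw
    · exact fun h hh => lower_mono m (hs _ _ _ _ hg hh) (hM g h)
    · intro v w hv hw
      rw [map_add]; exact add_mem hv hw
    · intro c v hv
      rw [map_smul]; exact Submodule.smul_mem _ _ hv
  · intro v w hv hw
    rw [map_add]; exact add_mem hv hw
  · intro c v hv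
    rw [map_smul]; exact Submodule.smul_mem _ _ hv

/-- The axioms satisfied by the structure constants `M` of a supportive multiplication. -/
structure IsMulFrame {𝕜 σ ι : Type*} [Field 𝕜] (hd : ι → ℕ) (m : ι → σ → ℤ)
    (D : (ι →₀ 𝕜) →ₗ[𝕜] (ι →₀ 𝕜)) (v₀ : ι →₀ 𝕜)
    (M : (ι →₀ 𝕜) →ₗ[𝕜] (ι →₀ 𝕜) →ₗ[𝕜] (ι →₀ 𝕜)) : Prop where
  support_le : ∀ g h,
    M (Finsupp.single g 1) (Finsupp.single h 1) ∈ lower 𝕜 m (m g ⊔ m h)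
  one_mul_one : M v₀ v₀ = v₀
  leibniz : ∀ g h, D (M (Finsupp.single g 1) (Finsupp.single h 1)) =
    M (D (Finsupp.single g 1)) (Finsupp.single h 1) +
      (-1 : ℤ) ^ hd g • M (Finsupp.single g 1) (D (Finsupp.single h 1))
  hdeg : ∀ g h, M (Finsupp.single g 1) (Finsupp.single h 1) ∈ level 𝕜 hd (hd g + hd h)
  comm : ∀ g h, M (Finsupp.single g 1) (Finsupp.single h 1) =
    (-1 : ℤ) ^ (hd g * hd h) • M (Finsupp.single h 1) (Finsupp.single g 1)

theorem IsMulFrame.relabel {𝕜 σ σ' ι : Type*} [Field 𝕜] {I : Ideal (MvPolynomial σ 𝕜)}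
    {I' : Ideal (MvPolynomial σ' 𝕜)} {ν : lcmLattice I ≃o lcmLattice I'} {hd : ι → ℕ}
    {m : ι → σ → ℤ} {m' : ι → σ' → ℤ} {D : (ι →₀ 𝕜) →ₗ[𝕜] (ι →₀ 𝕜)} {v₀ : ι →₀ 𝕜}
    {M : (ι →₀ 𝕜) →ₗ[𝕜] (ι →₀ 𝕜) →ₗ[𝕜] (ι →₀ 𝕜)} (h : IsMulFrame hd m D v₀ M)
    (hm : IsDegreeRelabeling ν m m') : IsMulFrame hd m' D v₀ M where
  support_le f g := mem_lower.2 fun k hk => hm.le_sup (mem_lower.1 (h.support_le f g) k hk)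
  one_mul_one := h.one_mul_one
  leibniz := h.leibniz
  hdeg := h.hdeg
  comm := h.comm

/-- For non-negative multidegrees the join is at most the sum, so all exponents in the product
formula are non-negative and `homog` loses no structure constant. -/
theorem IsMulFrame.mem_lower_add {𝕜 σ ι : Type*} [Field 𝕜] {hd : ι → ℕ} {m : ι → σ → ℤ}
    {D : (ι →₀ 𝕜) →ₗ[𝕜] (ι →₀ 𝕜)} {v₀ : ι →₀ 𝕜} {M : (ι →₀ 𝕜) →ₗ[𝕜] (ι →₀ 𝕜) →ₗ[𝕜] (ι →₀ 𝕜)}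
    (h : IsMulFrame hd m D v₀ M) (hm : ∀ g, 0 ≤ m g) (f g : ι) :
    M (Finsupp.single f 1) (Finsupp.single g 1) ∈ lower 𝕜 m (m f + m g) :=
  lower_mono m (sup_le (le_add_of_nonneg_right (hm g)) (le_add_of_nonneg_left (hm f)))
    (h.support_le f g)

namespace BasedComplex

section

variable {𝕜 σ ι F : Type*} [Field 𝕜] [Finite σ] [AddCommGroup F] [Module (MvPolynomial σ 𝕜) F]
  [Module 𝕜 F] [IsScalarTower 𝕜 (MvPolynomial σ 𝕜) F] {I : Ideal (MvPolynomial σ 𝕜)}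

/-- The bilinear map on `𝕜^ι` given by the structure constants of a multiplication. -/
def mulFrame (C : BasedComplex 𝕜 σ ι F) (mul : F →ₗ[MvPolynomial σ 𝕜] F →ₗ[MvPolynomial σ 𝕜] F) :
    (ι →₀ 𝕜) →ₗ[𝕜] (ι →₀ 𝕜) →ₗ[𝕜] (ι →₀ 𝕜) :=
  Finsupp.linearCombination 𝕜 fun g => Finsupp.linearCombination 𝕜 fun h =>
    strand C.basis C.mdeg (C.mdeg g + C.mdeg h) (mul (C.basis g) (C.basis h))

variable {C : BasedComplex 𝕜 σ ι F} {mul : F →ₗ[MvPolynomial σ 𝕜] F →ₗ[MvPolynomial σ 𝕜] F}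

theorem mulFrame_single (g h : ι) :
    C.mulFrame mul (Finsupp.single g 1) (Finsupp.single h 1) =
      strand C.basis C.mdeg (C.mdeg g + C.mdeg h) (mul (C.basis g) (C.basis h)) := by
  simp [mulFrame]

theorem mulConst_eq_mulFrame (g h k : ι) :
    C.mulConst mul g h k = C.mulFrame mul (Finsupp.single g 1) (Finsupp.single h 1) k := by
  rw [mulFrame_single]; rfl

theorem mulFrame_mem_lower {e f : σ → ℤ} {v w : ι →₀ 𝕜} (hv : v ∈ lower 𝕜 C.mdeg e)
    (hw : w ∈ lower 𝕜 C.mdeg f) : C.mulFrame mul v w ∈ lower 𝕜 C.mdeg (e + f) := by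
  refine map_mem_lower₂ (· + ·) (fun _ _ _ _ h h' => add_le_add h h') (fun g h => ?_) hv hw
  rw [mulFrame_single]
  exact strand_mem_lower _ _ _ _

theorem IsMultiplication.mul_homog (hmul : C.IsMultiplication mul) {e f : σ → ℤ} {v w : ι →₀ 𝕜}
    (hv : v ∈ lower 𝕜 C.mdeg e) (hw : w ∈ lower 𝕜 C.mdeg f) :
    mul (homog C.basis C.mdeg e v) (homog C.basis C.mdeg f w) =
      homog C.basis C.mdeg (e + f) (C.mulFrame mul v w) := by
  refine map_homog₂ (fun g h => ?_) (fun g h => ?_) hv hw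
  · exact mulFrame_mem_lower (single_mem_lower le_rfl 1) (single_mem_lower le_rfl 1)
  · rw [mulFrame_single]
    exact (hmul.multihomogeneous_mul _ _ _ _ (isMultihomogeneous_basis g)
      (isMultihomogeneous_basis h)).eq_homog

theorem IsMultiplication.strand_mul (hmul : C.IsMultiplication mul) {e f : σ → ℤ} {v w : ι →₀ 𝕜}
    (hv : v ∈ lower 𝕜 C.mdeg e) (hw : w ∈ lower 𝕜 C.mdeg f) :
    strand C.basis C.mdeg (e + f) (mul (homog C.basis C.mdeg e v) (homog C.basis C.mdeg f w)) =
      C.mulFrame mul v w := by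
  rw [hmul.mul_homog hv hw, strand_homog _ _ (mulFrame_mem_lower hv hw)]

theorem IsMultiplication.isMulFrame (hmul : C.IsMultiplication mul) (hs : C.IsSupportive mul)
    (hC : C.IsMinimalFreeResolution I) :
    IsMulFrame C.hdeg C.mdeg C.frame (strand C.basis C.mdeg 0 C.one) (C.mulFrame mul) where
  support_le g h := by
    obtain ⟨u, e, c, hc, he, hmc⟩ := hs _ _ _ _ (isMultihomogeneous_basis (C := C) g)
      (isMultihomogeneous_basis h)
    have hl := strand_mem_lower C.basis C.mdeg e c
    rw [mulFrame_single, hmc, hc.eq_homog, monomial_smul_homog _ _ _ hl]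
    -- The multidegrees of the two sides can differ only if the product is zero.
    by_cases heq : C.mdeg g + C.mdeg h = toMultidegree u + e
    · rw [heq, strand_homog _ _
        (lower_mono _ (le_add_of_nonneg_left (toMultidegree_nonneg u)) hl)]
      exact lower_mono _ he hl
    · rw [strand_homog_of_ne _ _ heq]
      exact zero_mem _
  one_mul_one := by
    have h0 := strand_mem_lower C.basis C.mdeg 0 C.one
    have h1 := hmul.strand_mul h0 h0
    rw [← hC.one_eq_homog, add_zero] at h1
    have h2 := hmul.mul_F0 1 1
    rw [one_smul, one_mul, one_smul] at h2
    rw [← h1, h2]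
  leibniz g h := by
    have hg : Finsupp.single g (1 : 𝕜) ∈ lower 𝕜 C.mdeg (C.mdeg g) := single_mem_lower le_rfl 1
    have hh : Finsupp.single h (1 : 𝕜) ∈ lower 𝕜 C.mdeg (C.mdeg h) := single_mem_lower le_rfl 1
    have key := congrArg (strand C.basis C.mdeg (C.mdeg g + C.mdeg h))
      (hmul.leibniz _ _ (basis_mem_hpart rfl : C.basis g ∈ C.hpart (C.hdeg g)) (C.basis h))
    rw [hC.strand_d, map_add, map_zsmul, hC.d_basis, hC.d_basis, ← mulFrame_single] at key
    rw [key, ← hmul.strand_mul (C.frame_mem_lower g) hh, ← hmul.strand_mul hg (C.frame_mem_lower h),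
      homog_single_self, homog_single_self]
  hdeg g h := by
    rw [mulFrame_single]
    exact mem_hpart.1 (hmul.hdeg_mul _ _ _ (basis_mem_hpart rfl) _ (basis_mem_hpart rfl)) _
  comm g h := by
    rw [mulFrame_single, mulFrame_single, add_comm (C.mdeg h), ← map_zsmul,
      ← hmul.graded_comm _ _ _ (basis_mem_hpart rfl) _ (basis_mem_hpart rfl)]

theorem IsMultiplication.mulFrame_one (hmul : C.IsMultiplication mul)
    (hC : C.IsMinimalFreeResolution I) (h1 : ∀ x, mul C.one x = x) (g : ι) :
    C.mulFrame mul (strand C.basis C.mdeg 0 C.one) (Finsupp.single g 1) = Finsupp.single g 1 := by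
  have hg : Finsupp.single g (1 : 𝕜) ∈ lower 𝕜 C.mdeg (C.mdeg g) := single_mem_lower le_rfl 1
  rw [← hmul.strand_mul (strand_mem_lower _ _ _ _) hg, ← hC.one_eq_homog, h1, zero_add,
    strand_homog _ _ hg]

end

/-! ### From a multiplication frame back to a supportive multiplication -/

section OfMulFrame

variable {𝕜 σ ι : Type*} [Field 𝕜] [Finite σ]

/-- The bilinear map with structure constants `M`. -/
def ofMulFrame (m : ι → σ → ℤ) (M : (ι →₀ 𝕜) →ₗ[𝕜] (ι →₀ 𝕜) →ₗ[𝕜] (ι →₀ 𝕜)) :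
    (ι →₀ MvPolynomial σ 𝕜) →ₗ[MvPolynomial σ 𝕜]
      (ι →₀ MvPolynomial σ 𝕜) →ₗ[MvPolynomial σ 𝕜] (ι →₀ MvPolynomial σ 𝕜) :=
  Finsupp.basisSingleOne.constr (MvPolynomial σ 𝕜) fun g =>
    Finsupp.basisSingleOne.constr (MvPolynomial σ 𝕜) fun h =>
      homog Finsupp.basisSingleOne m (m g + m h) (M (Finsupp.single g 1) (Finsupp.single h 1))

variable {hd : ι → ℕ} {m : ι → σ → ℤ} {D : (ι →₀ 𝕜) →ₗ[𝕜] (ι →₀ 𝕜)} {v₀ : ι →₀ 𝕜}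
  {M : (ι →₀ 𝕜) →ₗ[𝕜] (ι →₀ 𝕜) →ₗ[𝕜] (ι →₀ 𝕜)}

theorem ofMulFrame_basis (g h : ι) :
    ofMulFrame m M ((ofFrame hd m D v₀).basis g) ((ofFrame hd m D v₀).basis h) =
      homog (ofFrame hd m D v₀).basis m (m g + m h)
        (M (Finsupp.single g 1) (Finsupp.single h 1)) := by
  change ofMulFrame m M (Finsupp.basisSingleOne g) (Finsupp.basisSingleOne h) = _
  rw [ofMulFrame, Module.Basis.constr_basis, Module.Basis.constr_basis]
  rfl

theorem ofMulFrame_homog (h : IsMulFrame hd m D v₀ M) (hm : ∀ g, 0 ≤ m g) {e f : σ → ℤ}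
    {v w : ι →₀ 𝕜} (hv : v ∈ lower 𝕜 m e) (hw : w ∈ lower 𝕜 m f) :
    ofMulFrame m M (homog (ofFrame hd m D v₀).basis m e v)
      (homog (ofFrame hd m D v₀).basis m f w) =
        homog (ofFrame hd m D v₀).basis m (e + f) (M v w) :=
  map_homog₂ (h.mem_lower_add hm) ofMulFrame_basis hv hw

theorem ofMulFrame_of_isMultihomogeneous (h : IsMulFrame hd m D v₀ M) (hm : ∀ g, 0 ≤ m g)
    {e f : σ → ℤ} {a b : ι →₀ MvPolynomial σ 𝕜}
    (ha : (ofFrame hd m D v₀).IsMultihomogeneous e a)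
    (hb : (ofFrame hd m D v₀).IsMultihomogeneous f b) :
    ofMulFrame m M a b = homog (ofFrame hd m D v₀).basis m (e + f)
      (M (strand (ofFrame hd m D v₀).basis m e a) (strand (ofFrame hd m D v₀).basis m f b)) := by
  conv_lhs => rw [ha.eq_homog, hb.eq_homog]
  exact ofMulFrame_homog h hm (strand_mem_lower _ _ _ _) (strand_mem_lower _ _ _ _)

theorem mulFrame_ofMulFrame (h : IsMulFrame hd m D v₀ M) (hm : ∀ g, 0 ≤ m g) (f g : ι) :
    (ofFrame hd m D v₀).mulFrame (ofMulFrame m M) (Finsupp.single f 1) (Finsupp.single g 1) =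
      M (Finsupp.single f 1) (Finsupp.single g 1) := by
  rw [mulFrame_single, ofMulFrame_basis]
  exact strand_homog _ _ (h.mem_lower_add hm f g)

theorem isMultiplication_ofMulFrame {I : Ideal (MvPolynomial σ 𝕜)} (hF : IsFrame I hd m D v₀)
    (h : IsMulFrame hd m D v₀ M) (hm : ∀ g, 0 ≤ m g) :
    (ofFrame hd m D v₀).IsMultiplication (ofMulFrame m M) := by
  set C := ofFrame hd m D v₀ with hC
  have hs (g : ι) : Finsupp.single g (1 : 𝕜) ∈ lower 𝕜 m (m g) := single_mem_lower le_rfl 1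
  have d_homog {e : σ → ℤ} {v : ι →₀ 𝕜} (hv : v ∈ lower 𝕜 m e) :
      C.d (homog C.basis m e v) = homog C.basis m e (D v) :=
    map_homog hF.lower ofFrame_d_basis hv
  constructor
  · intro r s
    have : ofMulFrame m M C.one C.one = C.one := by
      have := ofMulFrame_homog h hm hF.one_mem_lower hF.one_mem_lower
      rw [h.one_mul_one, add_zero] at this
      exact this
    rw [map_smul, map_smul, LinearMap.smul_apply, this, smul_smul, mul_comm]
  · intro i a ha b
    revert b
    induction ha using Submodule.span_induction with
    | mem x hx =>
      obtain ⟨g, hg, rfl⟩ := hx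
      intro b
      refine LinearMap.congr_fun (f := C.d ∘ₗ ofMulFrame m M (C.basis g))
        (g := ofMulFrame m M (C.d (C.basis g)) +
          (-1 : ℤ) ^ i • (ofMulFrame m M (C.basis g) ∘ₗ C.d)) (C.basis.ext fun f => ?_) b
      have hg' : hd g = i := hg
      change C.d (ofMulFrame m M (C.basis g) (C.basis f)) =
        ofMulFrame m M (C.d (C.basis g)) (C.basis f) +
          (-1 : ℤ) ^ i • ofMulFrame m M (C.basis g) (C.d (C.basis f))
      rw [← homog_single_self (𝕜 := 𝕜) C.basis m g, ← homog_single_self (𝕜 := 𝕜) C.basis m f,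
        ofMulFrame_homog h hm (hs g) (hs f), d_homog (h.mem_lower_add hm g f), d_homog (hs g),
        d_homog (hs f), ofMulFrame_homog h hm (hF.lower g) (hs f),
        ofMulFrame_homog h hm (hs g) (hF.lower f), h.leibniz, map_add, map_zsmul, hg']
    | zero => simp
    | add x y _ _ hx hy =>
      intro b
      simp only [map_add, LinearMap.add_apply, hx, hy, smul_add]
      abel
    | smul c x _ hx =>
      intro b
      simp only [map_smul, LinearMap.smul_apply, hx, smul_add]
      rw [smul_comm c]
  · intro i j a ha b hb
    refine LinearMap.BilinMap.apply_apply_mem_of_mem_span (C.hpart (i + j)) _ _ _ ?_ a b ha hb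
    rintro _ ⟨g, rfl, rfl⟩ _ ⟨f, rfl, rfl⟩
    rw [ofMulFrame_basis]
    exact homog_mem_hpart (C := C) (h.hdeg g f) _
  · intro i j a ha b hb
    refine LinearMap.eqOn_span (f := (ofMulFrame m M).flip b)
      (g := (-1 : ℤ) ^ (i * j) • ofMulFrame m M b) ?_ ha
    rintro _ ⟨g, rfl, rfl⟩
    refine LinearMap.eqOn_span (f := ofMulFrame m M (C.basis g))
      (g := (-1 : ℤ) ^ (C.hdeg g * j) • (ofMulFrame m M).flip (C.basis g)) ?_ hb
    rintro _ ⟨f, rfl, rfl⟩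
    rw [LinearMap.smul_apply, LinearMap.flip_apply, ofMulFrame_basis, ofMulFrame_basis, h.comm,
      map_zsmul, add_comm (m f)]
    rfl
  · intro e f a b ha hb
    rw [ofMulFrame_of_isMultihomogeneous h hm ha hb]
    exact isMultihomogeneous_homog (C := C) (e + f) _

theorem isSupportive_ofMulFrame (h : IsMulFrame hd m D v₀ M) (hm : ∀ g, 0 ≤ m g) :
    (ofFrame hd m D v₀).IsSupportive (ofMulFrame m M) := by
  set C := ofFrame hd m D v₀ with hC
  intro e f a b ha hb
  have hmem (e x) : strand C.basis m e x ∈ lower 𝕜 m e := strand_mem_lower C.basis m e x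
  have hneg {e : σ → ℤ} (he : ¬ 0 ≤ e) (x) : strand C.basis m e x = 0 := by
    ext g
    by_contra hne
    exact he ((hm g).trans (mem_lower.1 (hmem e x) g hne))
  have hab := ofMulFrame_of_isMultihomogeneous h hm ha hb
  -- If `e` or `f` has a negative entry, one factor is zero. Otherwise the monomial `x^(e ⊓ f)` can
  -- be split off, because `e ⊓ f + e ⊔ f = e + f`.
  by_cases hef : 0 ≤ e ∧ 0 ≤ f
  · obtain ⟨u, hu⟩ := exists_toMultidegree_eq (le_inf hef.1 hef.2)
    have hl : M (strand C.basis m e a) (strand C.basis m f b) ∈ lower 𝕜 m (e ⊔ f) :=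
      map_mem_lower₂ (· ⊔ ·) (fun _ _ _ _ h h' => sup_le_sup h h') h.support_le
        (hmem e a) (hmem f b)
    refine ⟨u, e ⊔ f, homog C.basis m (e ⊔ f) (M (strand C.basis m e a) (strand C.basis m f b)),
      isMultihomogeneous_homog (C := C) _ _, le_rfl, ?_⟩
    rw [hab, monomial_smul_homog _ _ _ hl, hu, inf_add_sup]
  · refine ⟨0, e ⊔ f, 0, ?_, le_rfl, ?_⟩
    · simp [IsMultihomogeneous]
    · rw [hab, smul_zero]
      rcases not_and_or.1 hef with he | he
      · rw [hneg he, map_zero, LinearMap.zero_apply, map_zero]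
      · rw [hneg he, map_zero, map_zero]

theorem ofMulFrame_one {I : Ideal (MvPolynomial σ 𝕜)} (hF : IsFrame I hd m D v₀)
    (h : IsMulFrame hd m D v₀ M) (hm : ∀ g, 0 ≤ m g)
    (h1 : ∀ g, M v₀ (Finsupp.single g 1) = Finsupp.single g 1) (x : ι →₀ MvPolynomial σ 𝕜) :
    ofMulFrame m M (ofFrame hd m D v₀).one x = x := by
  refine LinearMap.congr_fun (g := LinearMap.id)
    ((ofFrame hd m D v₀).basis.ext fun g => ?_) x
  have := ofMulFrame_homog (hd := hd) (D := D) (v₀ := v₀) h hm hF.one_mem_lower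
    (single_mem_lower (le_refl (m g)) 1)
  rw [h1, zero_add, homog_single_self] at this
  exact this

end OfMulFrame

end BasedComplex

end

/-! ### The main theorem -/

open BasedComplex in
theorem proposition6p4 {𝕜 : Type*} [Field 𝕜] {σ σ' : Type*} [Finite σ] [Finite σ']
    (I : Ideal (MvPolynomial σ 𝕜)) (I' : Ideal (MvPolynomial σ' 𝕜))
    (hI : IsMonomialIdeal I) (hI' : IsMonomialIdeal I') (hI_ne : I ≠ ⊤) (hI'_ne : I' ≠ ⊤)
    (ν : lcmLattice I ≃o lcmLattice I')
    {ι F : Type*} [AddCommGroup F] [Module (MvPolynomial σ 𝕜) F]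
    (C : BasedComplex 𝕜 σ ι F) (hC : C.IsMinimalFreeResolution I) :
    ∃ C' : BasedComplex 𝕜 σ' ι (ι →₀ MvPolynomial σ' 𝕜),
      C'.basis = Finsupp.basisSingleOne ∧
      BasedComplex.IsRelabeling ν C C' ∧
      C'.IsMinimalFreeResolution I' ∧
      ∀ mul : F →ₗ[MvPolynomial σ 𝕜] F →ₗ[MvPolynomial σ 𝕜] F,
        C.IsMultiplication mul → C.IsSupportive mul →
        ∃ mul' : (ι →₀ MvPolynomial σ' 𝕜) →ₗ[MvPolynomial σ' 𝕜]
            (ι →₀ MvPolynomial σ' 𝕜) →ₗ[MvPolynomial σ' 𝕜] (ι →₀ MvPolynomial σ' 𝕜),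
          BasedComplex.IsMulRelabeling C C' mul mul' ∧
          C'.IsMultiplication mul' ∧ C'.IsSupportive mul' ∧
          ((∀ x, mul C.one x = x) → ∀ x, mul' C'.one x = x) := by
  -- `F` comes only with its `S`-module structure, while strands are `𝕜`-linear; scalars are
  -- restricted along `𝕜 → S`.
  let _ : Module 𝕜 F := Module.compHom F (algebraMap 𝕜 (MvPolynomial σ 𝕜))
  have : IsScalarTower 𝕜 (MvPolynomial σ 𝕜) F := IsScalarTower.of_compHom 𝕜 (MvPolynomial σ 𝕜) F
  have hF := hC.isFrame
  choose w hwL hw using hF.mdeg_mem_lcmLattice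
  set m' : ι → σ' → ℤ := fun g => toMultidegree (ν ⟨w g, hwL g⟩ : σ' →₀ ℕ) with hm'
  have hm : IsDegreeRelabeling ν C.mdeg m' := fun g => ⟨⟨w g, hwL g⟩, hw g, rfl⟩
  have hF' := hF.relabel hm hI_ne hI'_ne
  refine ⟨ofFrame C.hdeg m' C.frame (strand C.basis C.mdeg 0 C.one), rfl,
    ⟨fun _ => rfl, hm, fun g h => ?_⟩, isMinimalFreeResolution_ofFrame hI' hF', ?_⟩
  · rw [diffConst_eq_frame, diffConst_eq_frame, frame_ofFrame hF'.lower]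
  intro mul hmul hsupp
  have hM' := (hmul.isMulFrame hsupp hC).relabel hm
  refine ⟨ofMulFrame m' (C.mulFrame mul), fun f g h => ?_,
    isMultiplication_ofMulFrame hF' hM' hm.nonneg, isSupportive_ofMulFrame hM' hm.nonneg,
    fun h1 => ofMulFrame_one hF' hM' hm.nonneg (hmul.mulFrame_one hC h1)⟩
  rw [mulConst_eq_mulFrame, mulConst_eq_mulFrame, mulFrame_ofMulFrame hM' hm.nonneg]
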